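/- Let $\mathcal C$ be a Barr-exact category (a regular category with finite limits in which every internal equivalence relation is effective, i.e. is the kernel pair of its coequalizer), and let $\mathrm{Gpd}(\mathcal C)$ be the category of internal groupoids and internal functors in $\mathcal C$. For an internal groupoid $\mathbb G$ write $G_0$, $G_1$ for its objects of objects and of arrows, $d,c\colon G_1\to G_0$ for domain and codomain, $m$ for composition (in diagrammatic order) and $i$ for inversion. An internal functor $K=(k_0,k_1)\colon\mathbb X\to\mathbb Y$ between internal groupoids is a discrete fibration if the square $c\,k_1=k_0\,c$ is a pullback. An internal functor $F\colon\mathbb H\to\mathbb G$ between internal groupoids is final if it is left orthogonal in $\mathrm{Gpd}(\mathcal C)$ to all discrete fibrations: for every discrete fibration $K\colon\mathbb X\to\mathbb Y$ and all $U\colon\mathbb H\to\mathbb X$, $V\colon\mathbb G\to\mathbb Y$ with $KU=VF$ there is a unique $L\colon\mathbb G\to\mathbb X$ with $LF=U$ and $KL=V$. The groupoid $\operatorname{Dec}\mathbb G$ is the kernel pair $r_1,r_2\colon R_c\rightrightarrows G_1$ of $c\colon G_1\to G_0$, regarded as an internal groupoid with domain $r_1$ and codomain $r_2$, and $\varepsilon_{\mathbb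 G}\colon\operatorname{Dec}\mathbb G\to\mathbb G$ is the internal functor given by $d\colon G_1\to G_0$ on objects and by $m(r_1,i\,r_2)\colon R_c\to G_1$ on arrows. The functor $\pi_0\colon\mathrm{Gpd}(\mathcal C)\to\mathcal C$ sends $\mathbb H$ to the quotient of $H_0$ by the equivalence relation that is the regular image of $(d,c)\colon H_1\to H_0\times H_0$. Let $F\colon\mathbb H\to\mathbb G$ be an internal functor between internal groupoids in $\mathcal C$, and let $\overline F\colon\mathbb E\to\operatorname{Dec}\mathbb G$ be the pullback of $F$ along $\varepsilon_{\mathbb G}$ in $\mathrm{Gpd}(\mathcal C)$. Then $F$ is final if and only if $\pi_0(\overline F)$ is an isomorphism. -/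

import Mathlib

open CategoryTheory CategoryTheory.Limits

universe v u

section Groupoids

attribute [local simp] pullback.lift_fst pullback.lift_fst_assoc pullback.lift_snd
  pullback.lift_snd_assoc

/-- A Barr-exact category: a regular category (finite limits, coequalizers of kernel pairs,
regular epimorphisms stable under pullback) in which every internal equivalence relation is
effective, i.e. is the kernel pair of its coequalizer. -/
class BarrExact (C : Type u) [Category.{v} C] : Prop extends Regular C where
  isEffective {R X : C} (p₁ p₂ : R ⟶ X) :
    IsEquivalenceRelation p₁ p₂ → IsEffectiveEquivalenceRelation p₁ p₂

/-- An internal groupoid: objects `obj`, arrows `arr`, domain `d`, codomain `c`, identities `e`,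
composition `m` on composable pairs `(f, g)`, `c f = d g` (the composite `m (f, g)` goes from `d f`
to `c g`), and inversion `i`. Associativity is stated on generalized elements. -/
structure InternalGroupoid (C : Type u) [Category.{v} C] [HasPullbacks C] where
  obj : C
  arr : C
  d : arr ⟶ obj
  c : arr ⟶ obj
  e : obj ⟶ arr
  m : pullback c d ⟶ arr
  i : arr ⟶ arr
  e_d : e ≫ d = 𝟙 obj
  e_c : e ≫ c = 𝟙 obj
  m_d : m ≫ d = pullback.fst c d ≫ d
  m_c : m ≫ c = pullback.snd c d ≫ c
  e_m : pullback.lift (d ≫ e) (𝟙 arr) (by simp [e_c]) ≫ m = 𝟙 arr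
  m_e : pullback.lift (𝟙 arr) (c ≫ e) (by simp [e_d]) ≫ m = 𝟙 arr
  assoc : ∀ {T : C} (f g h : T ⟶ arr) (hfg : f ≫ c = g ≫ d) (hgh : g ≫ c = h ≫ d),
    pullback.lift (pullback.lift f g hfg ≫ m) h (by simp [m_c, hgh]) ≫ m =
      pullback.lift f (pullback.lift g h hgh ≫ m) (by simp [m_d, hfg]) ≫ m
  i_d : i ≫ d = c
  i_c : i ≫ c = d
  m_i : pullback.lift (𝟙 arr) i (by simp [i_d]) ≫ m = d ≫ e
  i_m : pullback.lift i (𝟙 arr) (by simp [i_c]) ≫ m = c ≫ e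

namespace InternalGroupoid

section Basic

variable {C : Type u} [Category.{v} C] [HasPullbacks C]

attribute [simp] e_d e_c i_d i_c

/-- Composition of generalized arrows. -/
noncomputable def comp (H : InternalGroupoid C) {T : C} (f g : T ⟶ H.arr)
    (h : f ≫ H.c = g ≫ H.d) : T ⟶ H.arr :=
  pullback.lift f g h ≫ H.m

section comp

variable (H : InternalGroupoid C) {T T' : C}

@[simp] lemma comp_d (f g : T ⟶ H.arr) (h : f ≫ H.c = g ≫ H.d) :
    H.comp f g h ≫ H.d = f ≫ H.d := by simp [comp, H.m_d]

@[simp] lemma comp_c (f g : T ⟶ H.arr) (h : f ≫ H.c = g ≫ H.d) :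
    H.comp f g h ≫ H.c = g ≫ H.c := by simp [comp, H.m_c]

lemma precomp (k : T' ⟶ T) (f g : T ⟶ H.arr) (h : f ≫ H.c = g ≫ H.d) :
    k ≫ H.comp f g h = H.comp (k ≫ f) (k ≫ g) (by simp [h]) := by
  simp only [comp, ← Category.assoc]
  congr 1
  ext <;> simp

lemma comp_congr {f f' g g' : T ⟶ H.arr} (hf : f = f') (hg : g = g')
    (h : f ≫ H.c = g ≫ H.d) : H.comp f g h = H.comp f' g' (by rw [← hf, ← hg, h]) := by
  subst hf hg; rfl

lemma m_eq : H.m = H.comp (pullback.fst H.c H.d) (pullback.snd H.c H.d) pullback.condition := by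
  simp only [comp]
  rw [show pullback.lift (pullback.fst H.c H.d) (pullback.snd H.c H.d) pullback.condition = 𝟙 _ by
    ext <;> simp]
  simp

lemma e_comp (f : T ⟶ H.arr) (x : T ⟶ H.obj) (hx : x = f ≫ H.d) :
    H.comp (x ≫ H.e) f (by simp [hx]) = f := by
  subst hx
  have h := f ≫= H.e_m
  rw [← comp, precomp] at h
  simpa using h

lemma comp_e (f : T ⟶ H.arr) (x : T ⟶ H.obj) (hx : x = f ≫ H.c) :
    H.comp f (x ≫ H.e) (by simp [hx]) = f := by
  subst hx
  have h := f ≫= H.m_e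
  rw [← comp, precomp] at h
  simpa using h

lemma comp_i (f : T ⟶ H.arr) : H.comp f (f ≫ H.i) (by simp) = f ≫ H.d ≫ H.e := by
  have h := f ≫= H.m_i
  rw [← comp, precomp] at h
  simpa using h

lemma i_comp (f : T ⟶ H.arr) : H.comp (f ≫ H.i) f (by simp) = f ≫ H.c ≫ H.e := by
  have h := f ≫= H.i_m
  rw [← comp, precomp] at h
  simpa using h

lemma comp_assoc (f g h : T ⟶ H.arr) (hfg : f ≫ H.c = g ≫ H.d) (hgh : g ≫ H.c = h ≫ H.d) :
    H.comp (H.comp f g hfg) h (by simp [hgh]) = H.comp f (H.comp g h hgh) (by simp [hfg]) :=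
  H.assoc f g h hfg hgh

end comp

/-- An internal functor. -/
@[ext]
structure Hom (H G : InternalGroupoid C) where
  f₀ : H.obj ⟶ G.obj
  f₁ : H.arr ⟶ G.arr
  d_f₀ : H.d ≫ f₀ = f₁ ≫ G.d
  c_f₀ : H.c ≫ f₀ = f₁ ≫ G.c
  e_f₁ : H.e ≫ f₁ = f₀ ≫ G.e
  m_f₁ : H.m ≫ f₁ = pullback.map H.c H.d G.c G.d f₁ f₁ f₀ c_f₀ d_f₀ ≫ G.m

lemma Hom.comp_f₁ {H G : InternalGroupoid C} (F : Hom H G) {T : C} (f g : T ⟶ H.arr)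
    (h : f ≫ H.c = g ≫ H.d) :
    H.comp f g h ≫ F.f₁ = G.comp (f ≫ F.f₁) (g ≫ F.f₁)
      (by rw [Category.assoc, Category.assoc, ← F.c_f₀, ← F.d_f₀, reassoc_of% h]) := by
  simp only [comp, Category.assoc, F.m_f₁]
  simp only [← Category.assoc]
  congr 1
  ext <;> simp [pullback.map]

/-- A pair of morphisms preserving composites of generalized arrows satisfies the condition on
composition in the definition of an internal functor. -/
lemma m_f₁_of_comp {H G : InternalGroupoid C} (f₀ : H.obj ⟶ G.obj) (f₁ : H.arr ⟶ G.arr)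
    (hd : H.d ≫ f₀ = f₁ ≫ G.d) (hc : H.c ≫ f₀ = f₁ ≫ G.c)
    (h : H.m ≫ f₁ = G.comp (pullback.fst H.c H.d ≫ f₁) (pullback.snd H.c H.d ≫ f₁)
      (by rw [Category.assoc, Category.assoc, ← hc, ← hd, pullback.condition_assoc])) :
    H.m ≫ f₁ = pullback.map H.c H.d G.c G.d f₁ f₁ f₀ hc hd ≫ G.m := by
  rw [h, comp]

/-- The category `Gpd(C)` of internal groupoids and internal functors. -/
instance : Category (InternalGroupoid C) where
  Hom := Hom
  id H :=
    { f₀ := 𝟙 _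
      f₁ := 𝟙 _
      d_f₀ := by simp
      c_f₀ := by simp
      e_f₁ := by simp
      m_f₁ := m_f₁_of_comp _ _ _ _ (by simp [← m_eq]) }
  comp F K :=
    { f₀ := F.f₀ ≫ K.f₀
      f₁ := F.f₁ ≫ K.f₁
      d_f₀ := by rw [← Category.assoc, F.d_f₀, Category.assoc, K.d_f₀, Category.assoc]
      c_f₀ := by rw [← Category.assoc, F.c_f₀, Category.assoc, K.c_f₀, Category.assoc]
      e_f₁ := by rw [← Category.assoc, F.e_f₁, Category.assoc, K.e_f₁, Category.assoc]
      m_f₁ := m_f₁_of_comp _ _ _ _ (by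
        rw [← Category.assoc, m_eq, F.comp_f₁, K.comp_f₁]
        simp) }
  id_comp _ := Hom.ext (Category.id_comp _) (Category.id_comp _)
  comp_id _ := Hom.ext (Category.comp_id _) (Category.comp_id _)
  assoc _ _ _ := Hom.ext (Category.assoc _ _ _) (Category.assoc _ _ _)

@[ext] lemma hom_ext {H G : InternalGroupoid C} {F K : H ⟶ G} (h₀ : F.f₀ = K.f₀)
    (h₁ : F.f₁ = K.f₁) : F = K := Hom.ext h₀ h₁

@[simp] lemma id_f₀ (H : InternalGroupoid C) : Hom.f₀ (𝟙 H) = 𝟙 H.obj := rfl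
@[simp] lemma id_f₁ (H : InternalGroupoid C) : Hom.f₁ (𝟙 H) = 𝟙 H.arr := rfl
@[simp] lemma comp_f₀ {H G K : InternalGroupoid C} (F : H ⟶ G) (F' : G ⟶ K) :
    (F ≫ F').f₀ = F.f₀ ≫ F'.f₀ := rfl
@[simp] lemma comp_f₁ {H G K : InternalGroupoid C} (F : H ⟶ G) (F' : G ⟶ K) :
    (F ≫ F').f₁ = F.f₁ ≫ F'.f₁ := rfl

lemma Hom.i_f₁ {H G : InternalGroupoid C} (F : Hom H G) : H.i ≫ F.f₁ = F.f₁ ≫ G.i := by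
  have hd : (H.i ≫ F.f₁) ≫ G.d = F.f₁ ≫ G.c := by
    rw [Category.assoc, ← F.d_f₀, ← Category.assoc, H.i_d, F.c_f₀]
  have hc : (H.i ≫ F.f₁) ≫ G.c = F.f₁ ≫ G.d := by
    rw [Category.assoc, ← F.c_f₀, ← Category.assoc, H.i_c, F.d_f₀]
  have key : G.comp (H.i ≫ F.f₁) F.f₁ hc = F.f₁ ≫ G.c ≫ G.e := by
    have h := H.i_comp (𝟙 _) =≫ F.f₁
    rw [F.comp_f₁] at h
    simp only [Category.id_comp, Category.assoc] at h
    rw [h, F.e_f₁, ← Category.assoc, F.c_f₀, Category.assoc]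
  have h := G.comp_assoc (H.i ≫ F.f₁) F.f₁ (F.f₁ ≫ G.i) hc (by simp)
  rw [G.comp_congr key rfl, G.comp_congr rfl (G.comp_i F.f₁)] at h
  have h1 := G.e_comp (F.f₁ ≫ G.i) (F.f₁ ≫ G.c) (by simp)
  have h2 := G.comp_e (H.i ≫ F.f₁) (F.f₁ ≫ G.d) hc.symm
  simp only [Category.assoc] at h h1 h2
  rw [← h1, ← h2, h]

/-- An internal functor is a discrete fibration if the square formed by the codomain maps is a
pullback. -/
def IsDiscreteFibration {H G : InternalGroupoid C} (F : H ⟶ G) : Prop :=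
  IsPullback F.f₁ H.c G.c F.f₀

/-- Final functors form the class (left) orthogonal to discrete fibrations in `Gpd(C)`. -/
def IsFinal {H G : InternalGroupoid C} (F : H ⟶ G) : Prop :=
  ∀ ⦃X Y : InternalGroupoid C⦄ (K : X ⟶ Y), IsDiscreteFibration K →
    ∀ (U : H ⟶ X) (V : G ⟶ Y), U ≫ K = F ≫ V → ∃! L : G ⟶ X, F ≫ L = U ∧ L ≫ K = V

/-- The internal equivalence relation given by the kernel pair of `f`, seen as an internal
groupoid: there is exactly one arrow from `x` to `y` when `f x = f y`. -/
noncomputable def kernelPair {X Y : C} (f : X ⟶ Y) : InternalGroupoid C where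
  obj := X
  arr := pullback f f
  d := pullback.fst f f
  c := pullback.snd f f
  e := pullback.lift (𝟙 X) (𝟙 X) rfl
  m := pullback.lift
    (pullback.fst (pullback.snd f f) (pullback.fst f f) ≫ pullback.fst f f)
    (pullback.snd (pullback.snd f f) (pullback.fst f f) ≫ pullback.snd f f)
    (by
      rw [Category.assoc, Category.assoc, pullback.condition, pullback.condition_assoc,
        pullback.condition])
  i := pullback.lift (pullback.snd f f) (pullback.fst f f) pullback.condition.symm
  e_d := by simp
  e_c := by simp
  m_d := by simp
  m_c := by simp
  e_m := by ext <;> simp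
  m_e := by ext <;> simp
  assoc _ _ _ _ _ := by ext <;> simp
  i_d := by simp
  i_c := by simp
  m_i := by ext <;> simp
  i_m := by ext <;> simp

/-- The décalage `Dec H`: its objects are the arrows of `H`, and its arrows are the pairs of arrows
of `H` with the same codomain. -/
noncomputable def dec (H : InternalGroupoid C) : InternalGroupoid C := kernelPair H.c

@[simp] lemma dec_d (H : InternalGroupoid C) : H.dec.d = pullback.fst H.c H.c := rfl
@[simp] lemma dec_c (H : InternalGroupoid C) : H.dec.c = pullback.snd H.c H.c := rfl

/-- The arrow component `(r₁, r₂) ↦ m (r₁, i r₂)` of the counit `Dec H ⟶ H`. -/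
noncomputable def dbar (H : InternalGroupoid C) : pullback H.c H.c ⟶ H.arr :=
  H.comp (pullback.fst H.c H.c) (pullback.snd H.c H.c ≫ H.i) (by simp [pullback.condition])

lemma dbar_d (H : InternalGroupoid C) : H.dbar ≫ H.d = pullback.fst H.c H.c ≫ H.d := by
  simp [dbar]

lemma dbar_c (H : InternalGroupoid C) : H.dbar ≫ H.c = pullback.snd H.c H.c ≫ H.d := by
  simp [dbar]

lemma precomp_dbar (H : InternalGroupoid C) {T : C} (p : T ⟶ pullback H.c H.c) (x y : T ⟶ H.arr)
    (hx : p ≫ pullback.fst H.c H.c = x) (hy : p ≫ pullback.snd H.c H.c = y) :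
    p ≫ H.dbar = H.comp x (y ≫ H.i)
      (by rw [← hx, ← hy]; simp [pullback.condition]) := by
  subst hx hy
  rw [dbar, precomp]
  exact H.comp_congr rfl (by simp) _

lemma comp_i_comp (H : InternalGroupoid C) {T : C} (x y z : T ⟶ H.arr)
    (hxy : x ≫ H.c = y ≫ H.c) (hyz : y ≫ H.c = z ≫ H.c) :
    H.comp (H.comp x (y ≫ H.i) (by simp [hxy])) (H.comp y (z ≫ H.i) (by simp [hyz]))
      (by simp) = H.comp x (z ≫ H.i) (by simp [hxy, hyz]) := by
  rw [comp_assoc _ _ _ _ (by simp [hxy]) (by simp)]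
  refine H.comp_congr rfl ?_ _
  rw [← comp_assoc _ _ _ _ (by simp) (by simp [hyz]), H.comp_congr (H.i_comp y) rfl]
  have h := H.e_comp (z ≫ H.i) (y ≫ H.c) (by simp [hyz])
  simpa using h

lemma diag_dbar (H : InternalGroupoid C) :
    pullback.lift (𝟙 H.arr) (𝟙 H.arr) rfl ≫ H.dbar = H.d ≫ H.e := by
  have h := H.comp_i (𝟙 _)
  simp only [Category.id_comp] at h
  refine (H.precomp_dbar _ _ _ (pullback.lift_fst _ _ _) (pullback.lift_snd _ _ _)).trans ?_
  rw [← h]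
  exact H.comp_congr rfl (Category.id_comp _) _

lemma comp_dbar (H : InternalGroupoid C) {T : C} (p q r : T ⟶ pullback H.c H.c)
    (hpq : p ≫ pullback.snd H.c H.c = q ≫ pullback.fst H.c H.c)
    (hp : r ≫ pullback.fst H.c H.c = p ≫ pullback.fst H.c H.c)
    (hq : r ≫ pullback.snd H.c H.c = q ≫ pullback.snd H.c H.c) :
    r ≫ H.dbar = H.comp (p ≫ H.dbar) (q ≫ H.dbar)
      (by rw [Category.assoc, Category.assoc, dbar_c, dbar_d, reassoc_of% hpq]) := by
  have e1 := H.precomp_dbar p _ _ rfl rfl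
  have e2 := H.precomp_dbar q _ _ hpq.symm rfl
  refine (H.precomp_dbar r _ _ hp hq).trans
    (Eq.symm ((H.comp_congr e1 e2 _).trans (H.comp_i_comp _ _ _ ?_ ?_)))
  · rw [Category.assoc, Category.assoc, pullback.condition]
  · rw [hpq, Category.assoc, Category.assoc, pullback.condition]

/-- The counit `ε_H : Dec H ⟶ H`, given by `d` on objects and by
`(r₁, r₂) ↦ m (r₁, i r₂)` on arrows. -/
noncomputable def decCounit (H : InternalGroupoid C) : H.dec ⟶ H where
  f₀ := H.d
  f₁ := H.dbar
  d_f₀ := H.dbar_d.symm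
  c_f₀ := H.dbar_c.symm
  e_f₁ := H.diag_dbar
  m_f₁ := m_f₁_of_comp _ _ _ _ (H.comp_dbar _ _ _ pullback.condition
    (pullback.lift_fst _ _ _) (pullback.lift_snd _ _ _))

section Pullback

variable {H H' G : InternalGroupoid C} (F : H ⟶ G) (K : H' ⟶ G)

/-- Domain map of the pullback groupoid. -/
noncomputable def pbD : pullback F.f₁ K.f₁ ⟶ pullback F.f₀ K.f₀ :=
  pullback.lift (pullback.fst _ _ ≫ H.d) (pullback.snd _ _ ≫ H'.d) (by
    rw [Category.assoc, Category.assoc, F.d_f₀, K.d_f₀, pullback.condition_assoc])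

/-- Codomain map of the pullback groupoid. -/
noncomputable def pbC : pullback F.f₁ K.f₁ ⟶ pullback F.f₀ K.f₀ :=
  pullback.lift (pullback.fst _ _ ≫ H.c) (pullback.snd _ _ ≫ H'.c) (by
    rw [Category.assoc, Category.assoc, F.c_f₀, K.c_f₀, pullback.condition_assoc])

/-- Identities of the pullback groupoid. -/
noncomputable def pbE : pullback F.f₀ K.f₀ ⟶ pullback F.f₁ K.f₁ :=
  pullback.lift (pullback.fst _ _ ≫ H.e) (pullback.snd _ _ ≫ H'.e) (by
    rw [Category.assoc, Category.assoc, F.e_f₁, K.e_f₁, pullback.condition_assoc])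

/-- Inversion of the pullback groupoid. -/
noncomputable def pbI : pullback F.f₁ K.f₁ ⟶ pullback F.f₁ K.f₁ :=
  pullback.lift (pullback.fst _ _ ≫ H.i) (pullback.snd _ _ ≫ H'.i) (by
    rw [Category.assoc, Category.assoc, F.i_f₁, K.i_f₁, pullback.condition_assoc])

lemma pbD_fst : pbD F K ≫ pullback.fst _ _ = pullback.fst _ _ ≫ H.d := pullback.lift_fst _ _ _
lemma pbD_snd : pbD F K ≫ pullback.snd _ _ = pullback.snd _ _ ≫ H'.d := pullback.lift_snd _ _ _
lemma pbC_fst : pbC F K ≫ pullback.fst _ _ = pullback.fst _ _ ≫ H.c := pullback.lift_fst _ _ _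
lemma pbC_snd : pbC F K ≫ pullback.snd _ _ = pullback.snd _ _ ≫ H'.c := pullback.lift_snd _ _ _
lemma pbE_fst : pbE F K ≫ pullback.fst _ _ = pullback.fst _ _ ≫ H.e := pullback.lift_fst _ _ _
lemma pbE_snd : pbE F K ≫ pullback.snd _ _ = pullback.snd _ _ ≫ H'.e := pullback.lift_snd _ _ _
lemma pbI_fst : pbI F K ≫ pullback.fst _ _ = pullback.fst _ _ ≫ H.i := pullback.lift_fst _ _ _
lemma pbI_snd : pbI F K ≫ pullback.snd _ _ = pullback.snd _ _ ≫ H'.i := pullback.lift_snd _ _ _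

lemma pb_composable_fst {T : C} {f g : T ⟶ pullback F.f₁ K.f₁}
    (h : f ≫ pbC F K = g ≫ pbD F K) :
    (f ≫ pullback.fst _ _) ≫ H.c = (g ≫ pullback.fst _ _) ≫ H.d := by
  have h' := h =≫ pullback.fst _ _
  rwa [Category.assoc, Category.assoc, pbC_fst, pbD_fst, ← Category.assoc, ← Category.assoc] at h'

lemma pb_composable_snd {T : C} {f g : T ⟶ pullback F.f₁ K.f₁}
    (h : f ≫ pbC F K = g ≫ pbD F K) :
    (f ≫ pullback.snd _ _) ≫ H'.c = (g ≫ pullback.snd _ _) ≫ H'.d := by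
  have h' := h =≫ pullback.snd _ _
  rwa [Category.assoc, Category.assoc, pbC_snd, pbD_snd, ← Category.assoc, ← Category.assoc] at h'

/-- Composition of the pullback groupoid. -/
noncomputable def pbM : pullback (pbC F K) (pbD F K) ⟶ pullback F.f₁ K.f₁ :=
  pullback.lift
    (H.comp (pullback.fst _ _ ≫ pullback.fst _ _) (pullback.snd _ _ ≫ pullback.fst _ _)
      (pb_composable_fst F K pullback.condition))
    (H'.comp (pullback.fst _ _ ≫ pullback.snd _ _) (pullback.snd _ _ ≫ pullback.snd _ _)
      (pb_composable_snd F K pullback.condition))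
    (by
      rw [F.comp_f₁, K.comp_f₁]
      exact G.comp_congr (by simp [pullback.condition]) (by simp [pullback.condition]) _)

lemma pbM_fst {T : C} (f g : T ⟶ pullback F.f₁ K.f₁) (h : f ≫ pbC F K = g ≫ pbD F K) :
    (pullback.lift f g h ≫ pbM F K) ≫ pullback.fst _ _ =
      H.comp (f ≫ pullback.fst _ _) (g ≫ pullback.fst _ _) (pb_composable_fst F K h) := by
  rw [Category.assoc, pbM, pullback.lift_fst, precomp]
  exact H.comp_congr (by simp) (by simp) _

lemma pbM_snd {T : C} (f g : T ⟶ pullback F.f₁ K.f₁) (h : f ≫ pbC F K = g ≫ pbD F K) :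
    (pullback.lift f g h ≫ pbM F K) ≫ pullback.snd _ _ =
      H'.comp (f ≫ pullback.snd _ _) (g ≫ pullback.snd _ _) (pb_composable_snd F K h) := by
  rw [Category.assoc, pbM, pullback.lift_snd, precomp]
  exact H'.comp_congr (by simp) (by simp) _

/-- The pullback of internal groupoids, computed on objects and on arrows. -/
noncomputable def pullbackGpd : InternalGroupoid C where
  obj := pullback F.f₀ K.f₀
  arr := pullback F.f₁ K.f₁
  d := pbD F K
  c := pbC F K
  e := pbE F K
  m := pbM F K
  i := pbI F K
  e_d := by
    apply pullback.hom_ext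
    · simp [pbD, pbE]
    · simp [pbD, pbE]
  e_c := by
    apply pullback.hom_ext
    · simp [pbC, pbE]
    · simp [pbC, pbE]
  m_d := by
    apply pullback.hom_ext
    · simp [pbD, pbM]
    · simp [pbD, pbM]
  m_c := by
    apply pullback.hom_ext
    · simp [pbC, pbM]
    · simp [pbC, pbM]
  e_m := by
    apply pullback.hom_ext
    · refine (pbM_fst F K _ _ _).trans (Eq.trans ?_ (Category.id_comp _).symm)
      refine (H.comp_congr ?_ (Category.id_comp _) _).trans (H.e_comp _ _ rfl)
      rw [Category.assoc, pbE_fst, ← Category.assoc, pbD_fst]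
    · refine (pbM_snd F K _ _ _).trans (Eq.trans ?_ (Category.id_comp _).symm)
      refine (H'.comp_congr ?_ (Category.id_comp _) _).trans (H'.e_comp _ _ rfl)
      rw [Category.assoc, pbE_snd, ← Category.assoc, pbD_snd]
  m_e := by
    apply pullback.hom_ext
    · refine (pbM_fst F K _ _ _).trans (Eq.trans ?_ (Category.id_comp _).symm)
      refine (H.comp_congr (Category.id_comp _) ?_ _).trans (H.comp_e _ _ rfl)
      rw [Category.assoc, pbE_fst, ← Category.assoc, pbC_fst]
    · refine (pbM_snd F K _ _ _).trans (Eq.trans ?_ (Category.id_comp _).symm)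
      refine (H'.comp_congr (Category.id_comp _) ?_ _).trans (H'.comp_e _ _ rfl)
      rw [Category.assoc, pbE_snd, ← Category.assoc, pbC_snd]
  assoc f g h hfg hgh := by
    apply pullback.hom_ext
    · refine (pbM_fst F K _ _ _).trans (Eq.trans ?_ (pbM_fst F K _ _ _).symm)
      refine (H.comp_congr (pbM_fst F K f g hfg) rfl _).trans (Eq.trans ?_
        (H.comp_congr rfl (pbM_fst F K g h hgh) _).symm)
      exact H.comp_assoc _ _ _ (pb_composable_fst F K hfg) (pb_composable_fst F K hgh)
    · refine (pbM_snd F K _ _ _).trans (Eq.trans ?_ (pbM_snd F K _ _ _).symm)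
      refine (H'.comp_congr (pbM_snd F K f g hfg) rfl _).trans (Eq.trans ?_
        (H'.comp_congr rfl (pbM_snd F K g h hgh) _).symm)
      exact H'.comp_assoc _ _ _ (pb_composable_snd F K hfg) (pb_composable_snd F K hgh)
  i_d := by
    apply pullback.hom_ext
    · simp [pbD, pbC, pbI]
    · simp [pbD, pbC, pbI]
  i_c := by
    apply pullback.hom_ext
    · simp [pbD, pbC, pbI]
    · simp [pbD, pbC, pbI]
  m_i := by
    apply pullback.hom_ext
    · refine (pbM_fst F K _ _ _).trans ((H.comp_congr (Category.id_comp _) (pbI_fst F K) _).trans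
        ((H.comp_i _).trans ?_))
      rw [Category.assoc, pbE_fst, ← Category.assoc, ← Category.assoc, pbD_fst]
    · refine (pbM_snd F K _ _ _).trans ((H'.comp_congr (Category.id_comp _) (pbI_snd F K) _).trans
        ((H'.comp_i _).trans ?_))
      rw [Category.assoc, pbE_snd, ← Category.assoc, ← Category.assoc, pbD_snd]
  i_m := by
    apply pullback.hom_ext
    · refine (pbM_fst F K _ _ _).trans ((H.comp_congr (pbI_fst F K) (Category.id_comp _) _).trans
        ((H.i_comp _).trans ?_))
      rw [Category.assoc, pbE_fst, ← Category.assoc, ← Category.assoc, pbC_fst]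
    · refine (pbM_snd F K _ _ _).trans ((H'.comp_congr (pbI_snd F K) (Category.id_comp _) _).trans
        ((H'.i_comp _).trans ?_))
      rw [Category.assoc, pbE_snd, ← Category.assoc, ← Category.assoc, pbC_snd]

/-- The first projection of the pullback of internal groupoids. -/
noncomputable def pullbackFst : pullbackGpd F K ⟶ H where
  f₀ := pullback.fst F.f₀ K.f₀
  f₁ := pullback.fst F.f₁ K.f₁
  d_f₀ := pbD_fst F K
  c_f₀ := pbC_fst F K
  e_f₁ := pbE_fst F K
  m_f₁ := m_f₁_of_comp _ _ _ _ (pullback.lift_fst _ _ _)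

/-- The second projection of the pullback of internal groupoids. -/
noncomputable def pullbackSnd : pullbackGpd F K ⟶ H' where
  f₀ := pullback.snd F.f₀ K.f₀
  f₁ := pullback.snd F.f₁ K.f₁
  d_f₀ := pbD_snd F K
  c_f₀ := pbC_snd F K
  e_f₁ := pbE_snd F K
  m_f₁ := m_f₁_of_comp _ _ _ _ (pullback.lift_snd _ _ _)

variable {F K} in
/-- The functor into the pullback induced by a commutative square. -/
noncomputable def pullbackLift {T : InternalGroupoid C}
    (U : T ⟶ H) (V : T ⟶ H') (w : U ≫ F = V ≫ K) : T ⟶ pullbackGpd F K :=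
  let l₀ : T.obj ⟶ pullback F.f₀ K.f₀ := pullback.lift U.f₀ V.f₀ (congrArg Hom.f₀ w)
  let l₁ : T.arr ⟶ pullback F.f₁ K.f₁ := pullback.lift U.f₁ V.f₁ (congrArg Hom.f₁ w)
  have hd : T.d ≫ l₀ = l₁ ≫ pbD F K := by
    apply pullback.hom_ext
    · simp [l₀, l₁, pbD, U.d_f₀]
    · simp [l₀, l₁, pbD, V.d_f₀]
  have hc : T.c ≫ l₀ = l₁ ≫ pbC F K := by
    apply pullback.hom_ext
    · simp [l₀, l₁, pbC, U.c_f₀]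
    · simp [l₀, l₁, pbC, V.c_f₀]
  { f₀ := l₀
    f₁ := l₁
    d_f₀ := hd
    c_f₀ := hc
    e_f₁ := show T.e ≫ l₁ = l₀ ≫ pbE F K by
      apply pullback.hom_ext
      · simp [l₀, l₁, pbE, U.e_f₁]
      · simp [l₀, l₁, pbE, V.e_f₁]
    m_f₁ := m_f₁_of_comp (G := pullbackGpd F K) l₀ l₁ hd hc (by
      apply pullback.hom_ext
      · refine Eq.trans ?_ (pbM_fst F K _ _ _).symm
        refine (Category.assoc _ _ _).trans ((congrArg _ (pullback.lift_fst _ _ _)).trans ?_)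
        rw [m_eq, Hom.comp_f₁]
        refine H.comp_congr ?_ ?_ _
        · exact ((Category.assoc _ _ _).trans (congrArg _ (pullback.lift_fst _ _ _))).symm
        · exact ((Category.assoc _ _ _).trans (congrArg _ (pullback.lift_fst _ _ _))).symm
      · refine Eq.trans ?_ (pbM_snd F K _ _ _).symm
        refine (Category.assoc _ _ _).trans ((congrArg _ (pullback.lift_snd _ _ _)).trans ?_)
        rw [m_eq, Hom.comp_f₁]
        refine H'.comp_congr ?_ ?_ _
        · exact ((Category.assoc _ _ _).trans (congrArg _ (pullback.lift_snd _ _ _))).symm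
        · exact ((Category.assoc _ _ _).trans (congrArg _ (pullback.lift_snd _ _ _))).symm) }

lemma isPullback_pullbackGpd :
    IsPullback (pullbackFst F K) (pullbackSnd F K) F K where
  w := hom_ext pullback.condition pullback.condition
  isLimit' := ⟨PullbackCone.IsLimit.mk _ (fun s => pullbackLift s.fst s.snd s.condition)
    (fun _ => hom_ext (pullback.lift_fst _ _ _) (pullback.lift_fst _ _ _))
    (fun _ => hom_ext (pullback.lift_snd _ _ _) (pullback.lift_snd _ _ _))
    (fun _ _ h₁ h₂ => hom_ext
      (pullback.hom_ext
        ((congrArg Hom.f₀ h₁).trans (pullback.lift_fst _ _ _).symm)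
        ((congrArg Hom.f₀ h₂).trans (pullback.lift_snd _ _ _).symm))
      (pullback.hom_ext
        ((congrArg Hom.f₁ h₁).trans (pullback.lift_fst _ _ _).symm)
        ((congrArg Hom.f₁ h₂).trans (pullback.lift_snd _ _ _).symm)))⟩

end Pullback

instance : HasPullbacks (InternalGroupoid C) :=
  have : ∀ {X Y Z : InternalGroupoid C} {F : X ⟶ Z} {K : Y ⟶ Z}, HasLimit (cospan F K) :=
    fun {_ _ _ F K} => (isPullback_pullbackGpd F K).hasPullback
  hasPullbacks_of_hasLimit_cospan _

end Basic

section Support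

variable {C : Type u} [Category.{v} C] [Regular C] (H : InternalGroupoid C)

/-- The regular image factorization of `(d, c) : H₁ ⟶ H₀ × H₀`. -/
noncomputable def supportFactorisation : StrongEpiMonoFactorisation (prod.lift H.d H.c) :=
  Regular.strongEpiMonoFactorisation _

/-- The object of arrows of the support `Σ H`. -/
noncomputable def support : C := H.supportFactorisation.I

/-- The regular epimorphism `H₁ ⟶ Σ H₁`. -/
noncomputable def supportπ : H.arr ⟶ H.support := H.supportFactorisation.e

/-- The first leg of the support relation on `H₀`. -/
noncomputable def support₁ : H.support ⟶ H.obj := H.supportFactorisation.m ≫ prod.fst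

/-- The second leg of the support relation on `H₀`. -/
noncomputable def support₂ : H.support ⟶ H.obj := H.supportFactorisation.m ≫ prod.snd

instance : IsRegularEpi H.supportπ :=
  inferInstanceAs (IsRegularEpi (Regular.strongEpiMonoFactorisation (prod.lift H.d H.c)).e)

@[simp] lemma supportπ_support₁ : H.supportπ ≫ H.support₁ = H.d := by
  refine (Category.assoc _ _ _).symm.trans ?_
  exact (H.supportFactorisation.fac =≫ prod.fst).trans (prod.lift_fst _ _)

@[simp] lemma supportπ_support₂ : H.supportπ ≫ H.support₂ = H.c := by
  refine (Category.assoc _ _ _).symm.trans ?_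
  exact (H.supportFactorisation.fac =≫ prod.snd).trans (prod.lift_snd _ _)

lemma support_hom_ext {T : C} (f g : T ⟶ H.support) (h₁ : f ≫ H.support₁ = g ≫ H.support₁)
    (h₂ : f ≫ H.support₂ = g ≫ H.support₂) : f = g := by
  have : Mono H.supportFactorisation.m := H.supportFactorisation.m_mono
  refine (cancel_mono H.supportFactorisation.m).1 ?_
  apply Limits.prod.hom_ext
  · exact (Category.assoc _ _ _).trans (h₁.trans (Category.assoc _ _ _).symm)
  · exact (Category.assoc _ _ _).trans (h₂.trans (Category.assoc _ _ _).symm)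

lemma mono_supportPair : Mono (prod.lift H.support₁ H.support₂) where
  right_cancellation f g h := H.support_hom_ext f g
    (by simpa [prod.lift_fst] using h =≫ prod.fst) (by simpa [prod.lift_snd] using h =≫ prod.snd)

/-- A relation on `H₀` which lifts to `H₁` along a regular epimorphism factors through the
support. -/
lemma exists_support_lift {A B : C} (p : A ⟶ B) [IsRegularEpi p] (t : A ⟶ H.support)
    (x y : B ⟶ H.obj) (hx : t ≫ H.support₁ = p ≫ x) (hy : t ≫ H.support₂ = p ≫ y) :
    ∃ l : B ⟶ H.support, l ≫ H.support₁ = x ∧ l ≫ H.support₂ = y := by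
  have := H.mono_supportPair
  have sq : CommSq t p (prod.lift H.support₁ H.support₂) (prod.lift x y) :=
    ⟨by apply Limits.prod.hom_ext <;> simp [hx, hy, prod.lift_fst, prod.lift_snd]⟩
  have hl := sq.fac_right
  exact ⟨sq.lift, by simpa [prod.lift_fst] using hl =≫ prod.fst, by simpa [prod.lift_snd] using hl =≫ prod.snd⟩

/-- The support of an internal groupoid is an internal equivalence relation. -/
lemma isEquivalenceRelation_support : IsEquivalenceRelation H.support₁ H.support₂ := by
  obtain ⟨s, hs₁, hs₂⟩ := H.exists_support_lift H.supportπ (H.i ≫ H.supportπ) H.support₂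
    H.support₁ (by simp) (by simp)
  obtain ⟨t, ht₁, ht₂⟩ : ∃ t : pullback H.support₂ H.support₁ ⟶ H.support,
      t ≫ H.support₁ = pullback.fst _ _ ≫ H.support₁ ∧
      t ≫ H.support₂ = pullback.snd _ _ ≫ H.support₂ := by
    -- cover both factors by `H₁`, compose there, and descend along the two covers
    let a := pullback.snd H.supportπ (pullback.fst H.support₂ H.support₁)
    let b := pullback.snd H.supportπ (a ≫ pullback.snd H.support₂ H.support₁)
    let g := pullback.fst H.supportπ (a ≫ pullback.snd H.support₂ H.support₁)
    let f := b ≫ pullback.fst H.supportπ (pullback.fst H.support₂ H.support₁)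
    have hg : g ≫ H.supportπ = b ≫ a ≫ pullback.snd H.support₂ H.support₁ := pullback.condition
    have hf : f ≫ H.supportπ = b ≫ a ≫ pullback.fst H.support₂ H.support₁ := by
      simp only [f, a, Category.assoc, pullback.condition]
    have hg₁ := hg =≫ H.support₁
    have hg₂ := hg =≫ H.support₂
    have hf₁ := hf =≫ H.support₁
    have hf₂ := hf =≫ H.support₂
    simp only [Category.assoc, supportπ_support₁, supportπ_support₂] at hg₁ hg₂ hf₁ hf₂
    have hfg : f ≫ H.c = g ≫ H.d := by rw [hf₂, hg₁, pullback.condition]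
    obtain ⟨l, hl₁, hl₂⟩ := H.exists_support_lift b (H.comp f g hfg ≫ H.supportπ)
      (a ≫ pullback.fst _ _ ≫ H.support₁) (a ≫ pullback.snd _ _ ≫ H.support₂)
      (by simpa using hf₁) (by simpa using hg₂)
    exact H.exists_support_lift a l _ _ hl₁ hl₂
  exact ⟨⟨{
    right_cancellation := fun _ f g => H.support_hom_ext f g
    r := H.e ≫ H.supportπ
    reflexivity₁ := by simp
    reflexivity₂ := by simp
    s := s
    symmetry₁ := hs₁
    symmetry₂ := hs₂
    c := pullback.cone H.support₂ H.support₁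
    isLimit := pullback.isLimit _ _
    t := t
    transitivity₁ := ht₁
    transitivity₂ := ht₂ }⟩⟩

end Support

section ConnectedComponents

variable {C : Type u} [Category.{v} C] [BarrExact C]

instance (H : InternalGroupoid C) : HasCoequalizer H.support₁ H.support₂ := by
  obtain ⟨⟨E⟩⟩ := BarrExact.isEffective _ _ H.isEquivalenceRelation_support
  exact ⟨⟨⟨_, E.isCoequalizer⟩⟩⟩

/-- The quotient map `q : H₀ ⟶ π₀ H` of the support of `H`. -/
noncomputable def quot (H : InternalGroupoid C) :
    H.obj ⟶ coequalizer H.support₁ H.support₂ := coequalizer.π _ _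

lemma d_quot (H : InternalGroupoid C) : H.d ≫ H.quot = H.c ≫ H.quot := by
  rw [← supportπ_support₁, ← supportπ_support₂, Category.assoc, Category.assoc]
  exact congrArg _ (coequalizer.condition _ _)

lemma support_quot {H G : InternalGroupoid C} (F : H ⟶ G) :
    H.support₁ ≫ F.f₀ ≫ G.quot = H.support₂ ≫ F.f₀ ≫ G.quot := by
  rw [← cancel_epi H.supportπ, ← Category.assoc, ← Category.assoc H.supportπ, supportπ_support₁,
    supportπ_support₂, ← Category.assoc, ← Category.assoc, F.d_f₀, F.c_f₀, Category.assoc,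
    Category.assoc, d_quot]

variable (C) in
/-- The connected components functor `π₀ : Gpd(C) ⥤ C`, sending `H` to the quotient of its support
equivalence relation. -/
noncomputable def π₀ : InternalGroupoid C ⥤ C where
  obj H := coequalizer H.support₁ H.support₂
  map {H G} F := coequalizer.desc (F.f₀ ≫ G.quot) (support_quot F)
  map_id H := by apply coequalizer.hom_ext; simp [quot]
  map_comp F K := by apply coequalizer.hom_ext; simp [quot]

end ConnectedComponents

end InternalGroupoid

end Groupoids

/-! An object of the pullback `E` of `F` along the counit is a pair `(x, g : F x ⟶ y)`. An arrow
from `(x, g)` to `(x', g')` is an arrow `k : x ⟶ x'` of `H` with `g = F k · g'`; in particular both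
pairs have the same `y`. So `E` is the family over `G₀` of the comma groupoids `F ↓ y`. Since `π₀
(Dec G)` is `G₀`, via `c`, the map in the theorem becomes the projection `p` from the object of
components `[x, g]` to `G₀`, sending `[x, g]` to `y` (`exists_fibreComponents_hom`).

If `p` is invertible, consider a lifting problem `(U, V)` against a discrete fibration. Unique
lifting of arrows forces `L y = U x · V g` for every `g : F x ⟶ y`, where the dot is transport along
`V g`. The right side is unchanged when `(x, g)` moves along an arrow of `H`, so it depends only on
the component `[x, g]`, that is, only on `y`. Thus `L` exists and is unique (`isFinal_of_isIso`).

Conversely, `G` acts on the components by `[x, g] · a = [x, g a]`, and the action groupoid is a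
discrete fibration over `G`. The assignment `x ↦ [x, 1]` lifts `F` to it. When `F` is final, this
lift extends to a section `L` of the projection, and equivariance gives `L y = L (F x) · g = [x, 1]
· g = [x, g]`. Hence `L` inverts `p` on objects (`isIso_of_isFinal`).

Elements are generalized elements, and a representative of a component exists only after a regular
epimorphic cover. Exactness makes equality of components mean being joined by an arrow on such a
cover (`exists_arr_of_toπ₀_eq`); this makes the action well defined. -/

namespace InternalGroupoid

attribute [local simp] pullback.lift_fst pullback.lift_fst_assoc pullback.lift_snd
  pullback.lift_snd_assoc

/-! ### Transport along discrete fibrations -/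

section RightLifting

variable {C : Type u} [Category.{v} C] [HasPullbacks C]

attribute [local simp] Hom.d_f₀ Hom.c_f₀

lemma i_i (H : InternalGroupoid C) : H.i ≫ H.i = 𝟙 H.arr := by
  have h := H.comp_assoc (H.i ≫ H.i) H.i (𝟙 _) (by simp) (by simp)
  rw [H.comp_congr (H.i_comp H.i) rfl] at h
  have h1 := H.i_comp (𝟙 H.arr)
  simp only [Category.id_comp] at h1
  rw [H.comp_congr rfl h1] at h
  have h2 := H.e_comp (𝟙 H.arr) (H.i ≫ H.c) (by simp)
  have h3 := H.comp_e (H.i ≫ H.i) H.c (by simp)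
  simp only [Category.assoc] at h h2 h3
  rw [← h2, ← h3, h]

lemma Hom.d_comm {H G : InternalGroupoid C} (F : H ⟶ G) : F.f₁ ≫ G.d = H.d ≫ F.f₀ :=
  (Hom.d_f₀ F).symm

lemma Hom.d_comm_assoc {H G : InternalGroupoid C} (F : H ⟶ G) {Z : C} (f : G.obj ⟶ Z) :
    F.f₁ ≫ G.d ≫ f = H.d ≫ F.f₀ ≫ f := by
  rw [← Category.assoc, Hom.d_comm, Category.assoc]

lemma Hom.c_comm {H G : InternalGroupoid C} (F : H ⟶ G) : F.f₁ ≫ G.c = H.c ≫ F.f₀ :=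
  (Hom.c_f₀ F).symm

lemma Hom.c_comm_assoc {H G : InternalGroupoid C} (F : H ⟶ G) {Z : C} (f : G.obj ⟶ Z) :
    F.f₁ ≫ G.c ≫ f = H.c ≫ F.f₀ ≫ f := by
  rw [← Category.assoc, Hom.c_comm, Category.assoc]

variable {X Y : InternalGroupoid C} {K : X ⟶ Y}

/-- A discrete fibration of internal groupoids is also a discrete opfibration. -/
lemma IsDiscreteFibration.isPullback_d (hK : IsDiscreteFibration K) :
    IsPullback K.f₁ X.d Y.d K.f₀ := by
  have hK : IsPullback K.f₁ X.c Y.c K.f₀ := hK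
  refine ⟨⟨Hom.d_comm K⟩, ⟨PullbackCone.IsLimit.mk _
    -- Lifting an arrow with prescribed domain amounts to lifting its inverse with prescribed
    -- codomain and inverting the result.
    (fun s => hK.lift (s.fst ≫ Y.i) s.snd (by simpa using s.condition) ≫ X.i)
    (fun s => ?_) (fun s => ?_) (fun s t h₁ h₂ => ?_)⟩⟩
  · rw [Category.assoc, Hom.i_f₁, ← Category.assoc, hK.lift_fst, Category.assoc, i_i,
      Category.comp_id]
  · rw [Category.assoc, X.i_d, hK.lift_snd]
  · rw [← Category.comp_id t, ← X.i_i, ← Category.assoc]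
    congr 1
    apply hK.hom_ext
    · rw [hK.lift_fst, Category.assoc, Hom.i_f₁, ← Category.assoc, h₁]
    · rw [hK.lift_snd, Category.assoc, X.i_c, h₂]

namespace IsDiscreteFibration

variable {T : C}

lemma arr_ext (hK : IsDiscreteFibration K) {b b' : T ⟶ X.arr} (hd : b ≫ X.d = b' ≫ X.d)
    (h₁ : b ≫ K.f₁ = b' ≫ K.f₁) :
    b = b' := IsPullback.hom_ext hK.isPullback_d h₁ hd

variable (hK : IsDiscreteFibration K)

/-- The lift of an arrow along a discrete fibration with prescribed domain. -/
noncomputable def push (x : T ⟶ X.obj) (a : T ⟶ Y.arr) (h : x ≫ K.f₀ = a ≫ Y.d) : T ⟶ X.arr :=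
  hK.isPullback_d.lift a x h.symm

@[simp] lemma push_d (x : T ⟶ X.obj) (a : T ⟶ Y.arr) (h : x ≫ K.f₀ = a ≫ Y.d) :
    hK.push x a h ≫ X.d = x := IsPullback.lift_snd _ _ _ _

@[simp] lemma push_f₁ (x : T ⟶ X.obj) (a : T ⟶ Y.arr) (h : x ≫ K.f₀ = a ≫ Y.d) :
    hK.push x a h ≫ K.f₁ = a := IsPullback.lift_fst _ _ _ _

/-- The transport of an object along an arrow of the base. -/
noncomputable def smul (x : T ⟶ X.obj) (a : T ⟶ Y.arr) (h : x ≫ K.f₀ = a ≫ Y.d) : T ⟶ X.obj :=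
  hK.push x a h ≫ X.c

lemma smul_congr {x x' : T ⟶ X.obj} {a a' : T ⟶ Y.arr} (hx : x = x') (ha : a = a')
    (h : x ≫ K.f₀ = a ≫ Y.d) : hK.smul x a h = hK.smul x' a' (by rw [← hx, ← ha, h]) := by
  subst hx ha; rfl

lemma smul_f₀ (x : T ⟶ X.obj) (a : T ⟶ Y.arr) (h : x ≫ K.f₀ = a ≫ Y.d) :
    hK.smul x a h ≫ K.f₀ = a ≫ Y.c := by
  rw [smul, Category.assoc, Hom.c_f₀, ← Category.assoc, push_f₁]

/-- By uniqueness of lifts, any arrow of `X` lying over `a` and starting at `x` computes the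
transport. The unit and composition laws below follow by exhibiting such an arrow: an identity, or a
composite of lifts. -/
lemma smul_eq (b : T ⟶ X.arr) (x : T ⟶ X.obj) (a : T ⟶ Y.arr) (hx : x = b ≫ X.d)
    (ha : a = b ≫ K.f₁) :
    hK.smul x a (by rw [hx, ha, Category.assoc, Category.assoc, Hom.d_f₀]) = b ≫ X.c := by
  rw [smul]
  congr 1
  exact hK.arr_ext (by simp [hx]) (by simp [ha])

lemma smul_e (x : T ⟶ X.obj) (y : T ⟶ Y.obj) (h : x ≫ K.f₀ = y) :
    hK.smul x (y ≫ Y.e) (by simp [h]) = x := by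
  rw [hK.smul_eq (x ≫ X.e) x _ (by simp)
    (by rw [Category.assoc, Hom.e_f₁, ← Category.assoc, h])]
  simp

lemma precomp_smul {T' : C} (k : T' ⟶ T) (x : T ⟶ X.obj) (a : T ⟶ Y.arr)
    (h : x ≫ K.f₀ = a ≫ Y.d) :
    k ≫ hK.smul x a h = hK.smul (k ≫ x) (k ≫ a) (by simp [h]) := by
  rw [hK.smul_eq (k ≫ hK.push x a h) (k ≫ x) (k ≫ a) (by simp) (by simp), smul, Category.assoc]

lemma smul_smul (x : T ⟶ X.obj) (a b : T ⟶ Y.arr) (h : x ≫ K.f₀ = a ≫ Y.d)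
    (hab : a ≫ Y.c = b ≫ Y.d) :
    hK.smul (hK.smul x a h) b (by rw [smul_f₀, hab]) =
      hK.smul x (Y.comp a b hab) (by simp [h]) := by
  have hc : hK.push x a h ≫ X.c =
      hK.push (hK.smul x a h) b (by rw [smul_f₀, hab]) ≫ X.d := by
    rw [push_d]; rfl
  rw [hK.smul_eq (X.comp (hK.push x a h) (hK.push (hK.smul x a h) b _) hc) x
    (Y.comp a b hab) (by simp), comp_c]
  · rfl
  · rw [Hom.comp_f₁]
    exact Y.comp_congr (by simp) (by simp) _

/-- A lift of a functor along a discrete fibration is determined by its components. -/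
noncomputable def liftHom {G : InternalGroupoid C} (V : G ⟶ Y) (l₀ : G.obj ⟶ X.obj)
    (l₁ : G.arr ⟶ X.arr)
    (h₀ : l₀ ≫ K.f₀ = V.f₀) (h₁ : l₁ ≫ K.f₁ = V.f₁) (hd : G.d ≫ l₀ = l₁ ≫ X.d)
    (hc : G.c ≫ l₀ = l₁ ≫ X.c) : G ⟶ X where
  f₀ := l₀
  f₁ := l₁
  d_f₀ := hd
  c_f₀ := hc
  -- Arrows of `X` are determined by their domain and their image in `Y`, so identities and
  -- composites need only be compared after these two projections.
  e_f₁ := hK.arr_ext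
    (by rw [Category.assoc, ← hd, ← Category.assoc, G.e_d]; simp)
    (by rw [Category.assoc, h₁, Hom.e_f₁, Category.assoc, Hom.e_f₁, ← Category.assoc, h₀])
  m_f₁ := m_f₁_of_comp _ _ _ _ <| hK.arr_ext
    (by rw [comp_d, Category.assoc, Category.assoc, ← hd, ← Category.assoc, ← Category.assoc,
      G.m_d])
    (by
      rw [Hom.comp_f₁, Category.assoc, h₁, m_eq, Hom.comp_f₁]
      exact Y.comp_congr (by rw [Category.assoc, h₁]) (by rw [Category.assoc, h₁]) _)

end IsDiscreteFibration

/-- The first component of an arrow of the pullback along `Dec G ⟶ G` sends one leg to the other. -/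
lemma comp_of_eq_dbar {G : InternalGroupoid C} {T : C} (a x y : T ⟶ G.arr)
    (hxy : x ≫ G.c = y ≫ G.c) (h : a = G.comp x (y ≫ G.i) (by simp [hxy])) :
    G.comp a y (by simp [h]) = x := by
  rw [G.comp_congr h rfl, comp_assoc _ _ _ _ _ (by simp), G.comp_congr rfl (G.i_comp y)]
  have := G.comp_e x (y ≫ G.c) hxy.symm
  simpa using this

/-- Converse of `comp_of_eq_dbar`: the equations `a = x y⁻¹` and `a y = x` are interchangeable, so
the first leg of an arrow of `Dec G` can be recovered from the second leg and the image under the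
counit. -/
lemma eq_dbar_of_comp {G : InternalGroupoid C} {T : C} (a x y : T ⟶ G.arr)
    (hay : a ≫ G.c = y ≫ G.d) (h : G.comp a y hay = x) :
    a = G.comp x (y ≫ G.i) (by simp [← h]) := by
  rw [G.comp_congr h.symm rfl, comp_assoc _ _ _ _ _ (by simp), G.comp_congr rfl (G.comp_i y)]
  have := G.comp_e a (y ≫ G.d) hay.symm
  simpa using this.symm

end RightLifting

/-! ### Connected components and local arrows -/

section Components

variable {C : Type u} [Category.{v} C] [BarrExact C] (H : InternalGroupoid C)

/-- The quotient map `H₀ ⟶ π₀ H`, with target the value of the functor `π₀`. -/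
noncomputable def toπ₀ : H.obj ⟶ (π₀ C).obj H := H.quot

instance : IsRegularEpi H.toπ₀ :=
  inferInstanceAs (IsRegularEpi (coequalizer.π H.support₁ H.support₂))

lemma d_toπ₀ : H.d ≫ H.toπ₀ = H.c ≫ H.toπ₀ := H.d_quot

/-- As `supportπ` is epic, coequalizing the support is the same as coequalizing `d` and `c`. -/
lemma exists_toπ₀_desc {Z : C} (f : H.obj ⟶ Z) (h : H.d ≫ f = H.c ≫ f) :
    ∃ g : (π₀ C).obj H ⟶ Z, H.toπ₀ ≫ g = f :=
  ⟨coequalizer.desc f (by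
    rw [← cancel_epi H.supportπ, ← Category.assoc, ← Category.assoc H.supportπ, supportπ_support₁,
      supportπ_support₂, h]), coequalizer.π_desc _ _⟩

lemma toπ₀_map {G : InternalGroupoid C} (F : H ⟶ G) :
    H.toπ₀ ≫ (π₀ C).map F = F.f₀ ≫ G.toπ₀ := coequalizer.π_desc _ _

/-- Two objects with the same connected component are, locally, joined by an arrow. -/
lemma exists_arr_of_toπ₀_eq {T : C} (x y : T ⟶ H.obj) (h : x ≫ H.toπ₀ = y ≫ H.toπ₀) :
    ∃ (T' : C) (s : T' ⟶ T) (t : T' ⟶ H.arr), IsRegularEpi s ∧ t ≫ H.d = s ≫ x ∧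
      t ≫ H.c = s ≫ y := by
  -- Exactness: the support is the kernel pair of `E.π`. This quotient need not be the chosen one,
  -- but it factors through `toπ₀`, which suffices to transfer the equality.
  obtain ⟨⟨E⟩⟩ := BarrExact.isEffective _ _ H.isEquivalenceRelation_support
  have hE : x ≫ E.π = y ≫ E.π := by
    obtain ⟨g, hg⟩ := H.exists_toπ₀_desc E.π (by
      rw [← supportπ_support₁, ← supportπ_support₂, Category.assoc, Category.assoc,
        E.isKernelPair.w])
    rw [← hg, ← Category.assoc, ← Category.assoc, h]
  let l := E.isKernelPair.lift x y hE
  -- The pair `(x, y)` factors through the support; pulling back the cover of the support by `H.arr`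
  -- supplies the arrow.
  refine ⟨_, pullback.snd H.supportπ l, pullback.fst H.supportπ l, inferInstance, ?_, ?_⟩
  · rw [← supportπ_support₁, pullback.condition_assoc, E.isKernelPair.lift_fst]
  · rw [← supportπ_support₂, pullback.condition_assoc, E.isKernelPair.lift_snd]

/-- The connected components of `Dec G` are the objects of `G`. -/
lemma exists_isIso_dec (G : InternalGroupoid C) :
    ∃ t : (π₀ C).obj G.dec ⟶ G.obj, IsIso t ∧
      (show G.arr ⟶ (π₀ C).obj G.dec from G.dec.toπ₀) ≫ t = G.c := by
  obtain ⟨t, ht⟩ := G.dec.exists_toπ₀_desc G.c pullback.condition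
  obtain ⟨q, hq⟩ : ∃ q : G.arr ⟶ (π₀ C).obj G.dec, q = G.dec.toπ₀ := ⟨_, rfl⟩
  have : IsRegularEpi q := hq ▸ inferInstanceAs (IsRegularEpi G.dec.toπ₀)
  have h₁ : q ≫ t = G.c := hq ▸ ht
  have h₂ : pullback.fst G.c G.c ≫ q = pullback.snd G.c G.c ≫ q := hq ▸ G.dec.d_toπ₀
  -- Every arrow is related in `Dec G` to the identity of its codomain, so `e` followed by the
  -- quotient map is inverse to `t`.
  have h := pullback.lift (𝟙 G.arr) (G.c ≫ G.e) (by simp) ≫= h₂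
  rw [pullback.lift_fst_assoc, pullback.lift_snd_assoc] at h
  refine ⟨t, ⟨G.e ≫ q, ?_, by rw [Category.assoc, h₁, G.e_c]⟩, ht⟩
  rw [← cancel_epi q, ← Category.assoc, h₁, Category.comp_id, ← Category.assoc, ← h,
    Category.id_comp]

end Components

/-! ### Components of the comma groupoids, and the lifting property -/

section Fibres

variable {C : Type u} [Category.{v} C] [BarrExact C] {H G : InternalGroupoid C} (F : H ⟶ G)

/-- The connected components of the pullback of `F` along `Dec G ⟶ G`. In the internal logic, this
is the family over `G₀` of the components of the comma categories of `F`. -/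
noncomputable def fibreComponents : C := (π₀ C).obj (pullbackGpd F G.decCounit)

/-- The quotient map sending `(h, g : F h ⟶ y)` to its connected component. -/
noncomputable def fibreπ : pullback F.f₀ G.d ⟶ fibreComponents F :=
  (pullbackGpd F G.decCounit).toπ₀

instance : IsRegularEpi (fibreπ F) :=
  inferInstanceAs (IsRegularEpi (pullbackGpd F G.decCounit).toπ₀)

variable {F} {T : C}

lemma lift_comp_condition (k : T ⟶ H.arr) (g : T ⟶ G.arr) (h : (k ≫ F.f₁) ≫ G.c = g ≫ G.d) :
    (k ≫ H.d) ≫ F.f₀ = G.comp (k ≫ F.f₁) g h ≫ G.d := by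
  rw [comp_d, Category.assoc, Category.assoc, Hom.d_f₀]

lemma lift_condition (k : T ⟶ H.arr) (g : T ⟶ G.arr) (h : (k ≫ F.f₁) ≫ G.c = g ≫ G.d) :
    (k ≫ H.c) ≫ F.f₀ = g ≫ G.d := by
  rw [← h, Category.assoc, Category.assoc, Hom.c_f₀]

/-- An arrow of the pullback is an arrow `k` of `H` with a pair `(x, y)` such that `F k = x y⁻¹`.
Then `x = F k · y`, so the data reduce to `k` and `g = y`. The converse construction is
`exists_arr`. -/
lemma arr_condition (t : T ⟶ (pullbackGpd F G.decCounit).arr) :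
    ∃ (k : T ⟶ H.arr) (g : T ⟶ G.arr) (h : (k ≫ F.f₁) ≫ G.c = g ≫ G.d),
      t ≫ (pullbackGpd F G.decCounit).d =
        pullback.lift (k ≫ H.d) (G.comp (k ≫ F.f₁) g h) (lift_comp_condition k g h) ∧
      t ≫ (pullbackGpd F G.decCounit).c =
        pullback.lift (k ≫ H.c) g (lift_condition k g h) := by
  obtain ⟨t, rfl⟩ : ∃ t' : T ⟶ pullback F.f₁ G.dbar, t' = t := ⟨t, rfl⟩
  let x := t ≫ pullback.snd F.f₁ G.dbar ≫ pullback.fst G.c G.c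
  let y := t ≫ pullback.snd F.f₁ G.dbar ≫ pullback.snd G.c G.c
  have hxy : x ≫ G.c = y ≫ G.c := by simp [x, y, pullback.condition]
  have hk : (t ≫ pullback.fst F.f₁ G.dbar) ≫ F.f₁ = G.comp x (y ≫ G.i) (by simp [hxy]) := by
    rw [Category.assoc, pullback.condition, ← Category.assoc]
    exact G.precomp_dbar _ _ _ (by simp [x]) (by simp [y])
  refine ⟨t ≫ pullback.fst _ _, y, by simp [hk], ?_, ?_⟩
  · apply pullback.hom_ext
    · refine Eq.trans ?_ (pullback.lift_fst _ _ _).symm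
      exact (Category.assoc _ _ _).trans ((congrArg _ (pbD_fst F G.decCounit)).trans
        (Category.assoc _ _ _).symm)
    · refine Eq.trans ?_ (pullback.lift_snd _ _ _).symm
      refine (Category.assoc _ _ _).trans ((congrArg _ (pbD_snd F G.decCounit)).trans ?_)
      exact (comp_of_eq_dbar _ x y hxy hk).symm
  · apply pullback.hom_ext
    · refine Eq.trans ?_ (pullback.lift_fst _ _ _).symm
      exact (Category.assoc _ _ _).trans ((congrArg _ (pbC_fst F G.decCounit)).trans
        (Category.assoc _ _ _).symm)
    · refine Eq.trans ?_ (pullback.lift_snd _ _ _).symm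
      exact (Category.assoc _ _ _).trans (congrArg _ (pbC_snd F G.decCounit))

lemma exists_arr (k : T ⟶ H.arr) (g : T ⟶ G.arr) (h : (k ≫ F.f₁) ≫ G.c = g ≫ G.d) :
    ∃ t : T ⟶ (pullbackGpd F G.decCounit).arr,
      t ≫ (pullbackGpd F G.decCounit).d =
        pullback.lift (k ≫ H.d) (G.comp (k ≫ F.f₁) g h) (lift_comp_condition k g h) ∧
      t ≫ (pullbackGpd F G.decCounit).c =
        pullback.lift (k ≫ H.c) g (lift_condition k g h) := by
  let r : T ⟶ pullback G.c G.c := pullback.lift (G.comp (k ≫ F.f₁) g h) g (by simp)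
  have hr : k ≫ F.f₁ = r ≫ G.dbar :=
    (eq_dbar_of_comp _ _ _ h rfl).trans
      (G.precomp_dbar r _ _ (pullback.lift_fst _ _ _) (pullback.lift_snd _ _ _)).symm
  let t : T ⟶ pullback F.f₁ G.dbar := pullback.lift k r hr
  have h₁ : t ≫ pullback.fst F.f₁ G.dbar = k := pullback.lift_fst _ _ _
  have h₂ : t ≫ pullback.snd F.f₁ G.dbar = r := pullback.lift_snd _ _ _
  refine ⟨t, ?_, ?_⟩
  · apply pullback.hom_ext
    · refine Eq.trans ?_ (pullback.lift_fst _ _ _).symm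
      refine (Category.assoc _ _ _).trans ((congrArg _ (pbD_fst F G.decCounit)).trans ?_)
      exact (Category.assoc _ _ _).symm.trans (h₁ =≫ _)
    · refine Eq.trans ?_ (pullback.lift_snd _ _ _).symm
      refine (Category.assoc _ _ _).trans ((congrArg _ (pbD_snd F G.decCounit)).trans ?_)
      exact (Category.assoc _ _ _).symm.trans ((h₂ =≫ pullback.fst G.c G.c).trans
        (pullback.lift_fst _ _ _))
  · apply pullback.hom_ext
    · refine Eq.trans ?_ (pullback.lift_fst _ _ _).symm
      refine (Category.assoc _ _ _).trans ((congrArg _ (pbC_fst F G.decCounit)).trans ?_)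
      exact (Category.assoc _ _ _).symm.trans (h₁ =≫ _)
    · refine Eq.trans ?_ (pullback.lift_snd _ _ _).symm
      refine (Category.assoc _ _ _).trans ((congrArg _ (pbC_snd F G.decCounit)).trans ?_)
      exact (Category.assoc _ _ _).symm.trans ((h₂ =≫ pullback.snd G.c G.c).trans
        (pullback.lift_snd _ _ _))

lemma lift_comp_fibreπ (k : T ⟶ H.arr) (g : T ⟶ G.arr) (h : (k ≫ F.f₁) ≫ G.c = g ≫ G.d) :
    pullback.lift (k ≫ H.d) (G.comp (k ≫ F.f₁) g h) (lift_comp_condition k g h) ≫ fibreπ F =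
      pullback.lift (k ≫ H.c) g (lift_condition k g h) ≫ fibreπ F := by
  obtain ⟨t, h₁, h₂⟩ := exists_arr k g h
  have := t ≫= (pullbackGpd F G.decCounit).d_toπ₀
  rw [← Category.assoc, ← Category.assoc] at this
  exact (h₁ =≫ _).symm.trans (this.trans (h₂ =≫ _))

/-- A map out of `F ↓ G` that is invariant under the arrows of `H` factors through the
components. -/
lemma exists_fibreπ_desc {Z : C} (f : pullback F.f₀ G.d ⟶ Z)
    (hf : ∀ ⦃T : C⦄ (k : T ⟶ H.arr) (g : T ⟶ G.arr) (h : (k ≫ F.f₁) ≫ G.c = g ≫ G.d),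
      pullback.lift (k ≫ H.d) (G.comp (k ≫ F.f₁) g h) (lift_comp_condition k g h) ≫ f =
        pullback.lift (k ≫ H.c) g (lift_condition k g h) ≫ f) :
    ∃ l : fibreComponents F ⟶ Z, fibreπ F ≫ l = f := by
  -- Invariance is needed only for the universal arrow of the pullback.
  obtain ⟨k, g, h, h₁, h₂⟩ := arr_condition (𝟙 (pullbackGpd F G.decCounit).arr)
  rw [Category.id_comp] at h₁ h₂
  exact (pullbackGpd F G.decCounit).exists_toπ₀_desc f
    ((h₁ =≫ f).trans ((hf k g h).trans (h₂ =≫ f).symm))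

/-- Two objects of `F ↓ G` in the same component are, locally, related by an arrow of `H`. -/
lemma exists_arr_of_fibreπ_eq (x y : T ⟶ pullback F.f₀ G.d)
    (hxy : x ≫ fibreπ F = y ≫ fibreπ F) :
    ∃ (T' : C) (s : T' ⟶ T) (k : T' ⟶ H.arr) (g : T' ⟶ G.arr)
      (h : (k ≫ F.f₁) ≫ G.c = g ≫ G.d), IsRegularEpi s ∧
      s ≫ x = pullback.lift (k ≫ H.d) (G.comp (k ≫ F.f₁) g h) (lift_comp_condition k g h) ∧
      s ≫ y = pullback.lift (k ≫ H.c) g (lift_condition k g h) := by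
  obtain ⟨T', s, t, hs, h₁, h₂⟩ := (pullbackGpd F G.decCounit).exists_arr_of_toπ₀_eq x y hxy
  obtain ⟨k, g, h, h₃, h₄⟩ := arr_condition t
  exact ⟨T', s, k, g, h, hs, h₁.symm.trans h₃, h₂.symm.trans h₄⟩

variable (F) in
-- The map `p` is `π₀` of the second projection followed by the isomorphism from `π₀ (Dec G)` to
-- `G₀`. Isolating its defining equation removes `Dec G` from both directions of the theorem.
lemma exists_fibreComponents_hom :
    ∃ p : fibreComponents F ⟶ G.obj, fibreπ F ≫ p = pullback.snd F.f₀ G.d ≫ G.c ∧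
      (IsIso ((π₀ C).map (pullback.snd F G.decCounit)) ↔ IsIso p) := by
  obtain ⟨t, ht, hc⟩ := G.exists_isIso_dec
  refine ⟨(π₀ C).map (pullbackSnd F G.decCounit) ≫ t, ?_, ?_⟩
  · have h := toπ₀_map (pullbackGpd F G.decCounit) (pullbackSnd F G.decCounit) =≫ t
    rw [Category.assoc, Category.assoc] at h
    exact h.trans (congrArg (pullback.snd F.f₀ G.d ≫ ·) hc)
  -- The chosen pullback differs from the componentwise one by an isomorphism, which does not affect
  -- invertibility.
  · let e := (isPullback_pullbackGpd (F := F) (K := G.decCounit)).isoPullback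
    have he : e.hom ≫ pullback.snd F G.decCounit = pullbackSnd F G.decCounit :=
      IsPullback.isoPullback_hom_snd _
    refine Iff.trans ?_ (isIso_comp_right_iff ((π₀ C).map (pullbackSnd F G.decCounit)) t).symm
    rw [← he, Functor.map_comp, isIso_comp_left_iff]

/-- If the components of `F ↓ G` are the objects of `G`, then `F` is final. -/
lemma isFinal_of_isIso (p : fibreComponents F ⟶ G.obj)
    (hp : fibreπ F ≫ p = pullback.snd F.f₀ G.d ≫ G.c) [IsIso p] : IsFinal F := by
  intro X Y K hK U V w
  have w₀ : U.f₀ ≫ K.f₀ = F.f₀ ≫ V.f₀ := congrArg Hom.f₀ w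
  have w₁ : U.f₁ ≫ K.f₁ = F.f₁ ≫ V.f₁ := congrArg Hom.f₁ w
  have hUV {T : C} (x : T ⟶ H.obj) (g : T ⟶ G.arr) (h : x ≫ F.f₀ = g ≫ G.d) :
      (x ≫ U.f₀) ≫ K.f₀ = (g ≫ V.f₁) ≫ Y.d := by
    rw [Category.assoc, Category.assoc, w₀, reassoc_of% h, Hom.d_f₀]
  -- The map `f (x, g) = U x · V g` is the value that any solution must take at the codomain of `g`.
  obtain ⟨f, hf⟩ : ∃ f : pullback F.f₀ G.d ⟶ X.obj,
      ∀ {T : C} (x : T ⟶ H.obj) (g : T ⟶ G.arr) (h : x ≫ F.f₀ = g ≫ G.d),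
        pullback.lift x g h ≫ f = hK.smul (x ≫ U.f₀) (g ≫ V.f₁) (hUV x g h) := by
    refine ⟨hK.smul _ _ (hUV _ _ pullback.condition), fun x g h => ?_⟩
    rw [hK.precomp_smul]
    exact hK.smul_congr (by simp) (by simp) _
  obtain ⟨q, hq⟩ : ∃ q : pullback F.f₀ G.d ⟶ G.obj, q = pullback.snd F.f₀ G.d ≫ G.c := ⟨_, rfl⟩
  -- Locally, every object of `G` receives an arrow from some `F x`.
  have : IsRegularEpi q := by
    rw [hq, ← hp]
    exact (MorphismProperty.cancel_right_of_respectsIso (.regularEpi C) (fibreπ F) p).2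
      (inferInstanceAs (IsRegularEpi (fibreπ F)))
  obtain ⟨l₀, hl₀⟩ : ∃ l₀ : G.obj ⟶ X.obj, q ≫ l₀ = f := by
    -- Invariance, for `k : x ⟶ x'`: `U x · V (F k · g) = (U x · K (U k)) · V g = U x' · V g`,
    -- because `U k` is itself the lift of `V (F k)` at `U x`.
    obtain ⟨l, hl⟩ := exists_fibreπ_desc f (fun T k g h => by
      have hkg : ((k ≫ F.f₁) ≫ V.f₁) ≫ Y.c = (g ≫ V.f₁) ≫ Y.d := by
        have := h =≫ V.f₀
        simpa [Hom.c_f₀, Hom.d_f₀] using this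
      have hk : (k ≫ U.f₁) ≫ K.f₁ = (k ≫ F.f₁) ≫ V.f₁ := by
        rw [Category.assoc, w₁, Category.assoc]
      rw [hf, hf, hK.smul_congr rfl (Hom.comp_f₁ V _ _ h),
        ← hK.smul_smul _ _ _ (by simp [Hom.d_comm, w₀, Hom.d_comm_assoc]) hkg]
      refine hK.smul_congr ?_ rfl _
      rw [hK.smul_eq (k ≫ U.f₁) _ _ (by simp [Hom.d_comm]) hk.symm]
      simp [Hom.c_comm])
    refine ⟨inv p ≫ l, ?_⟩
    rw [hq, ← hp, Category.assoc, IsIso.hom_inv_id_assoc, hl]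
  have key {T : C} (x : T ⟶ H.obj) (g : T ⟶ G.arr) (h : x ≫ F.f₀ = g ≫ G.d) :
      (g ≫ G.c) ≫ l₀ = hK.smul (x ≫ U.f₀) (g ≫ V.f₁) (hUV x g h) := by
    rw [← hf x g h, ← hl₀, hq]
    simp
  have key' := key _ _ pullback.condition
  rw [← hq] at key'
  have hl₀K : l₀ ≫ K.f₀ = V.f₀ := by
    rw [← cancel_epi q, ← Category.assoc, key', hK.smul_f₀, hq, Category.assoc, Category.assoc,
      Hom.c_f₀]
  have hd : (G.d ≫ l₀) ≫ K.f₀ = V.f₁ ≫ Y.d := by rw [Category.assoc, hl₀K, Hom.d_f₀]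
  have hc : G.c ≫ l₀ = hK.push (G.d ≫ l₀) V.f₁ hd ≫ X.c := by
    change _ = hK.smul _ _ _
    -- On the cover `a`, the domain of the given arrow receives some `g : F x ⟶ d a`. Both sides
    -- then equal `U x · V (g a)`, by `key` applied to `g a` and to `g`.
    let a := pullback.snd q G.d
    let z := pullback.fst q G.d
    have hza : (z ≫ pullback.snd F.f₀ G.d) ≫ G.c = a ≫ G.d := by
      rw [Category.assoc, ← hq]; exact pullback.condition
    have hzz : (z ≫ pullback.fst F.f₀ G.d) ≫ F.f₀ = (z ≫ pullback.snd F.f₀ G.d) ≫ G.d := by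
      simp [pullback.condition]
    have hV : ((z ≫ pullback.snd F.f₀ G.d) ≫ V.f₁) ≫ Y.c = (a ≫ V.f₁) ≫ Y.d := by
      have := hza =≫ V.f₀
      simpa [Hom.c_f₀, Hom.d_f₀] using this
    rw [← cancel_epi a, hK.precomp_smul, ← Category.assoc,
      ← G.comp_c (z ≫ pullback.snd F.f₀ G.d) a hza,
      key (z ≫ pullback.fst _ _) _ (by rw [comp_d, hzz]),
      hK.smul_congr rfl (Hom.comp_f₁ V _ _ hza), ← hK.smul_smul _ _ _ (hUV _ _ hzz) hV]
    refine hK.smul_congr ?_ rfl _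
    rw [← key _ _ hzz, hza, Category.assoc]
  let L : G ⟶ X := hK.liftHom V l₀ (hK.push (G.d ≫ l₀) V.f₁ hd) hl₀K (hK.push_f₁ _ _ _)
    (hK.push_d _ _ _).symm hc
  have hFL₀ : F.f₀ ≫ l₀ = U.f₀ := by
    -- Evaluation at the identity of `F x`, which acts trivially.
    have h := key (𝟙 _) (F.f₀ ≫ G.e) (by simp)
    rw [hK.smul_congr (Category.id_comp _) (a' := (F.f₀ ≫ V.f₀) ≫ Y.e)
      (by rw [Category.assoc, Hom.e_f₁, Category.assoc]), hK.smul_e _ _ w₀] at h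
    simpa using h
  refine ⟨L, ⟨hom_ext hFL₀ (hK.arr_ext ?_ ?_), hom_ext hl₀K (hK.push_f₁ _ _ hd)⟩, ?_⟩
  · change (F.f₁ ≫ hK.push (G.d ≫ l₀) V.f₁ hd) ≫ X.d = U.f₁ ≫ X.d
    rw [Category.assoc, hK.push_d, Hom.d_comm_assoc, hFL₀, Hom.d_comm]
  · change (F.f₁ ≫ hK.push (G.d ≫ l₀) V.f₁ hd) ≫ K.f₁ = U.f₁ ≫ K.f₁
    rw [Category.assoc, hK.push_f₁, w₁]
  · rintro L' ⟨hL'F, hL'K⟩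
    have h₀ : F.f₀ ≫ L'.f₀ = U.f₀ := congrArg Hom.f₀ hL'F
    have h₁ : L'.f₁ ≫ K.f₁ = V.f₁ := congrArg Hom.f₁ hL'K
    -- For `g : F x ⟶ y`, the arrow `L' g` lies over `V g` and starts at `L' (F x) = U x`, so it
    -- computes the same transport.
    have h₂ : L'.f₀ = l₀ := by
      rw [← cancel_epi q, key', hK.smul_eq (pullback.snd F.f₀ G.d ≫ L'.f₁), hq, Category.assoc,
        Category.assoc, Hom.c_f₀]
      · rw [Category.assoc, Hom.d_comm, ← pullback.condition_assoc, h₀]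
      · rw [Category.assoc, h₁]
    refine hom_ext h₂ (hK.arr_ext ?_ ?_)
    · change L'.f₁ ≫ X.d = hK.push (G.d ≫ l₀) V.f₁ hd ≫ X.d
      rw [hK.push_d, ← h₂, Hom.d_f₀]
    · change L'.f₁ ≫ K.f₁ = hK.push (G.d ≫ l₀) V.f₁ hd ≫ K.f₁
      rw [hK.push_f₁, h₁]

end Fibres

/-! ### Right actions and their action groupoids -/

section Action

variable {C : Type u} [Category.{v} C] [HasPullbacks C]

/-- A right action of an internal groupoid `G` on an object `p : P ⟶ G₀` over its objects. -/
structure RightAction (G : InternalGroupoid C) where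
  P : C
  p : P ⟶ G.obj
  act : pullback p G.d ⟶ P
  act_p : act ≫ p = pullback.snd p G.d ≫ G.c
  act_e : pullback.lift (𝟙 P) (p ≫ G.e) (by simp) ≫ act = 𝟙 P
  act_act : ∀ {T : C} (x : T ⟶ P) (a b : T ⟶ G.arr) (h : x ≫ p = a ≫ G.d)
    (hab : a ≫ G.c = b ≫ G.d),
    pullback.lift (pullback.lift x a h ≫ act) b (by simp [act_p, hab]) ≫ act =
      pullback.lift x (G.comp a b hab) (by simp [h]) ≫ act

namespace RightAction

variable {G : InternalGroupoid C} (A : RightAction G) {T : C}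

/-- The action on generalized elements. -/
noncomputable def smul (x : T ⟶ A.P) (a : T ⟶ G.arr) (h : x ≫ A.p = a ≫ G.d) : T ⟶ A.P :=
  pullback.lift x a h ≫ A.act

lemma smul_congr {x x' : T ⟶ A.P} {a a' : T ⟶ G.arr} (hx : x = x') (ha : a = a')
    (h : x ≫ A.p = a ≫ G.d) : A.smul x a h = A.smul x' a' (by rw [← hx, ← ha, h]) := by
  subst hx ha; rfl

@[simp] lemma smul_p (x : T ⟶ A.P) (a : T ⟶ G.arr) (h : x ≫ A.p = a ≫ G.d) :
    A.smul x a h ≫ A.p = a ≫ G.c := by simp [smul, A.act_p]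

lemma precomp_smul {T' : C} (k : T' ⟶ T) (x : T ⟶ A.P) (a : T ⟶ G.arr)
    (h : x ≫ A.p = a ≫ G.d) :
    k ≫ A.smul x a h = A.smul (k ≫ x) (k ≫ a) (by simp [h]) := by
  simp only [smul, ← Category.assoc]
  congr 1
  ext <;> simp

lemma smul_e (x : T ⟶ A.P) (y : T ⟶ G.obj) (h : x ≫ A.p = y) :
    A.smul x (y ≫ G.e) (by simp [h]) = x := by
  subst h
  have h := x ≫= A.act_e
  change x ≫ A.smul (𝟙 _) (A.p ≫ G.e) _ = _ at h
  rw [precomp_smul] at h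
  simpa using h

lemma smul_smul (x : T ⟶ A.P) (a b : T ⟶ G.arr) (h : x ≫ A.p = a ≫ G.d)
    (hab : a ≫ G.c = b ≫ G.d) :
    A.smul (A.smul x a h) b (by simp [hab]) = A.smul x (G.comp a b hab) (by simp [h]) :=
  A.act_act x a b h hab

lemma act_eq : A.act = A.smul (pullback.fst _ _) (pullback.snd _ _) pullback.condition := by
  rw [smul, show pullback.lift (pullback.fst A.p G.d) (pullback.snd _ _) pullback.condition = 𝟙 _ by
    ext <;> simp]
  simp

lemma lift_act (x : T ⟶ A.P) (a : T ⟶ G.arr) (h : x ≫ A.p = a ≫ G.d) :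
    pullback.lift x a h ≫ A.act = A.smul x a h := rfl

lemma precomp_act (t : T ⟶ pullback A.p G.d) :
    t ≫ A.act = A.smul (t ≫ pullback.fst _ _) (t ≫ pullback.snd _ _)
      (by simp [pullback.condition]) := by
  rw [act_eq, precomp_smul]

lemma composable {f g : T ⟶ pullback A.p G.d} (h : f ≫ A.act = g ≫ pullback.fst A.p G.d) :
    (f ≫ pullback.snd A.p G.d) ≫ G.c = (g ≫ pullback.snd A.p G.d) ≫ G.d := by
  have := h =≫ A.p
  simpa [A.act_p, pullback.condition] using this

/-- Composition in the action groupoid. -/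
noncomputable def comp (f g : T ⟶ pullback A.p G.d)
    (h : f ≫ A.act = g ≫ pullback.fst A.p G.d) : T ⟶ pullback A.p G.d :=
  pullback.lift (f ≫ pullback.fst A.p G.d) (G.comp _ _ (A.composable h))
    (by simp [pullback.condition])

lemma lift_comp (f g : T ⟶ pullback A.p G.d) (h : f ≫ A.act = g ≫ pullback.fst A.p G.d) :
    pullback.lift f g h ≫ A.comp _ _ pullback.condition = A.comp f g h := by
  apply pullback.hom_ext
  · simp [comp]
  · simp only [comp, Category.assoc, pullback.lift_snd]
    rw [precomp]
    exact G.comp_congr (by simp) (by simp) _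

@[simp] lemma comp_fst (f g : T ⟶ pullback A.p G.d)
    (h : f ≫ A.act = g ≫ pullback.fst A.p G.d) :
    A.comp f g h ≫ pullback.fst _ _ = f ≫ pullback.fst _ _ := pullback.lift_fst _ _ _

lemma comp_snd (f g : T ⟶ pullback A.p G.d) (h : f ≫ A.act = g ≫ pullback.fst A.p G.d) :
    A.comp f g h ≫ pullback.snd _ _ =
      G.comp (f ≫ pullback.snd _ _) (g ≫ pullback.snd _ _) (A.composable h) :=
  pullback.lift_snd _ _ _

lemma comp_act (f g : T ⟶ pullback A.p G.d) (h : f ≫ A.act = g ≫ pullback.fst A.p G.d) :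
    A.comp f g h ≫ A.act = g ≫ A.act := by
  rw [comp, lift_act, ← A.smul_smul _ _ _ (by simp [pullback.condition]), A.precomp_act g]
  exact A.smul_congr (by rw [← A.precomp_act, h]) rfl _

/-- The action groupoid of a right action. -/
noncomputable def groupoid : InternalGroupoid C where
  obj := A.P
  arr := pullback A.p G.d
  d := pullback.fst A.p G.d
  c := A.act
  e := pullback.lift (𝟙 _) (A.p ≫ G.e) (by simp)
  m := A.comp _ _ pullback.condition
  i := pullback.lift A.act (pullback.snd _ _ ≫ G.i) (by simp [A.act_p])
  e_d := by simp
  e_c := A.act_e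
  m_d := by simp
  m_c := A.comp_act _ _ _
  e_m := by
    rw [lift_comp]
    apply pullback.hom_ext
    · simp
    · rw [comp_snd]
      refine (G.comp_congr ?_ rfl _).trans (G.e_comp (𝟙 _ ≫ pullback.snd A.p G.d)
        (pullback.fst A.p G.d ≫ A.p) (by simp [pullback.condition]))
      simp
  m_e := by
    rw [lift_comp]
    apply pullback.hom_ext
    · simp
    · rw [comp_snd]
      refine (G.comp_congr rfl ?_ _).trans (G.comp_e (𝟙 _ ≫ pullback.snd A.p G.d)
        (A.act ≫ A.p) (by simp [A.act_p]))
      simp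
  assoc f g h hfg hgh := by
    refine (A.lift_comp _ _ ?_).trans (Eq.trans ?_ (A.lift_comp _ _ ?_).symm)
    · apply pullback.hom_ext
      · refine (A.comp_fst _ _ _).trans ((A.lift_comp f g hfg =≫ _).trans ?_)
        rw [comp_fst, comp_fst]
      · rw [comp_snd, comp_snd]
        refine (G.comp_congr (by rw [A.lift_comp f g hfg, comp_snd]) rfl _).trans (Eq.trans ?_
          (G.comp_congr rfl (by rw [A.lift_comp g h hgh, comp_snd]) _).symm)
        exact G.comp_assoc _ _ _ (A.composable hfg) (A.composable hgh)
    · rw [A.lift_comp g h hgh, comp_fst, hfg]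
  i_d := by simp
  i_c := by
    rw [lift_act, A.smul_congr A.act_eq rfl, A.smul_smul _ _ _ _ (by simp),
      A.smul_congr rfl (G.comp_i _)]
    simpa using A.smul_e _ _ pullback.condition
  m_i := by
    rw [lift_comp]
    apply pullback.hom_ext
    · simp
    · rw [comp_snd]
      refine (G.comp_congr rfl ?_ _).trans ((G.comp_i (𝟙 _ ≫ pullback.snd A.p G.d)).trans ?_)
      · simp
      · simp [pullback.condition_assoc]
  i_m := by
    rw [lift_comp]
    apply pullback.hom_ext
    · simp
    · rw [comp_snd]
      refine (G.comp_congr ?_ rfl _).trans ((G.i_comp (𝟙 _ ≫ pullback.snd A.p G.d)).trans ?_)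
      · simp
      · simp [reassoc_of% A.act_p]

/-- The projection of the action groupoid. -/
noncomputable def proj : A.groupoid ⟶ G where
  f₀ := A.p
  f₁ := pullback.snd A.p G.d
  d_f₀ := pullback.condition
  c_f₀ := A.act_p
  e_f₁ := pullback.lift_snd _ _ _
  m_f₁ := m_f₁_of_comp _ _ _ _ (A.comp_snd _ _ pullback.condition)

/-- Because arrows of `G` are invertible, the only arrow over `a` ending at `x` is the one starting
at `x · a⁻¹`. -/
lemma isDiscreteFibration_proj : IsDiscreteFibration A.proj := by
  change IsPullback (pullback.snd A.p G.d) A.act G.c A.p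
  have key {T : C} (x : T ⟶ A.P) (a b : T ⟶ G.arr) (h : x ≫ A.p = a ≫ G.d)
      (hab : a ≫ G.c = b ≫ G.d) (hb : G.comp a b hab = a ≫ G.d ≫ G.e) :
      A.smul (A.smul x a h) b (by simp [hab]) = x := by
    rw [A.smul_smul _ _ _ _ hab, A.smul_congr rfl hb]
    simpa using A.smul_e x (a ≫ G.d) h
  refine ⟨⟨A.act_p.symm⟩, ⟨PullbackCone.IsLimit.mk _
    (fun s => pullback.lift (A.smul s.snd (s.fst ≫ G.i) (by simpa using s.condition.symm)) s.fst
      (by simp)) (fun s => pullback.lift_snd _ _ _) (fun s => ?_) (fun s t h₁ h₂ => ?_)⟩⟩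
  · exact key _ _ _ _ (by simp)
      ((G.i_comp s.fst).trans (by rw [Category.assoc, ← Category.assoc G.i, G.i_d]))
  · apply pullback.hom_ext
    · rw [pullback.lift_fst, A.smul_congr h₂.symm (by rw [← h₁]),
        A.smul_congr (A.precomp_act t) rfl]
      exact (key _ _ _ _ (by simp) (by simpa using G.comp_i (t ≫ pullback.snd _ _))).symm
    · rw [pullback.lift_snd, h₁]

end RightAction

end Action

/-! ### Postcomposition on comma objects -/

section Comma

variable {C : Type u} [Category.{v} C] [HasPullbacks C] {H G : InternalGroupoid C} {F : H ⟶ G}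
  {T : C}

lemma precomp_lift {X Y Z T T' : C} {f : X ⟶ Z} {g : Y ⟶ Z} (s : T' ⟶ T) (x : T ⟶ X) (y : T ⟶ Y)
    (h : x ≫ f = y ≫ g) :
    s ≫ pullback.lift x y h = pullback.lift (s ≫ x) (s ≫ y) (by simp [h]) := by
  apply pullback.hom_ext <;> simp

lemma lift_congr {X Y Z T : C} {f : X ⟶ Z} {g : Y ⟶ Z} {a a' : T ⟶ X} {b b' : T ⟶ Y}
    (ha : a = a') (hb : b = b') (h : a ≫ f = b ≫ g) :
    pullback.lift a b h = pullback.lift a' b' (by rw [← ha, ← hb, h]) := by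
  subst ha hb; rfl

/-- Postcomposition of an object `(x, g : F x ⟶ y)` of `F ↓ G` with an arrow of `G`. -/
noncomputable def commaComp (z : T ⟶ pullback F.f₀ G.d) (a : T ⟶ G.arr)
    (h : (z ≫ pullback.snd F.f₀ G.d) ≫ G.c = a ≫ G.d) : T ⟶ pullback F.f₀ G.d :=
  pullback.lift (z ≫ pullback.fst F.f₀ G.d) (G.comp _ a h) (by simp [pullback.condition])

@[simp] lemma commaComp_fst (z : T ⟶ pullback F.f₀ G.d) (a : T ⟶ G.arr)
    (h : (z ≫ pullback.snd F.f₀ G.d) ≫ G.c = a ≫ G.d) :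
    commaComp z a h ≫ pullback.fst F.f₀ G.d = z ≫ pullback.fst F.f₀ G.d := pullback.lift_fst _ _ _

@[simp] lemma commaComp_snd (z : T ⟶ pullback F.f₀ G.d) (a : T ⟶ G.arr)
    (h : (z ≫ pullback.snd F.f₀ G.d) ≫ G.c = a ≫ G.d) :
    commaComp z a h ≫ pullback.snd F.f₀ G.d = G.comp (z ≫ pullback.snd F.f₀ G.d) a h :=
  pullback.lift_snd _ _ _

lemma commaComp_congr {z z' : T ⟶ pullback F.f₀ G.d} {a a' : T ⟶ G.arr} (hz : z = z')
    (ha : a = a') (h : (z ≫ pullback.snd F.f₀ G.d) ≫ G.c = a ≫ G.d) :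
    commaComp z a h = commaComp z' a' (by rw [← hz, ← ha, h]) := by
  subst hz ha; rfl

lemma precomp_commaComp {T' : C} (k : T' ⟶ T) (z : T ⟶ pullback F.f₀ G.d) (a : T ⟶ G.arr)
    (h : (z ≫ pullback.snd F.f₀ G.d) ≫ G.c = a ≫ G.d) :
    k ≫ commaComp z a h = commaComp (k ≫ z) (k ≫ a) (by
      simpa only [Category.assoc] using k ≫= h) := by
  apply pullback.hom_ext
  · simp
  · rw [Category.assoc, commaComp_snd, commaComp_snd, precomp]
    exact G.comp_congr (by simp) rfl _

lemma commaComp_commaComp (z : T ⟶ pullback F.f₀ G.d) (a b : T ⟶ G.arr)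
    (h : (z ≫ pullback.snd F.f₀ G.d) ≫ G.c = a ≫ G.d) (hab : a ≫ G.c = b ≫ G.d) :
    commaComp (commaComp z a h) b (by simp [hab]) =
      commaComp z (G.comp a b hab) (by simpa using h) := by
  apply pullback.hom_ext
  · simp
  · refine (commaComp_snd _ _ _).trans (Eq.trans ?_ (commaComp_snd _ _ _).symm)
    exact (G.comp_congr (commaComp_snd _ _ _) rfl _).trans (G.comp_assoc _ _ _ h hab)

lemma commaComp_e (z : T ⟶ pullback F.f₀ G.d) (y : T ⟶ G.obj)
    (h : y = (z ≫ pullback.snd F.f₀ G.d) ≫ G.c) :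
    commaComp z (y ≫ G.e) (by simp [h]) = z := by
  apply pullback.hom_ext
  · simp
  · rw [commaComp_snd, G.comp_e _ _ h]

end Comma

/-! ### The action on components, and its use for final functors -/

section Fibres

variable {C : Type u} [Category.{v} C] [BarrExact C] {H G : InternalGroupoid C} {F : H ⟶ G}

/-- Locally an arrow `k` of `H` joins `z` to `z'`. By associativity the same `k` joins their
composites with `a`, and equality descends along the cover. -/
lemma commaComp_fibreπ_congr {T : C} (z z' : T ⟶ pullback F.f₀ G.d) (a : T ⟶ G.arr)
    (h : (z ≫ pullback.snd F.f₀ G.d) ≫ G.c = a ≫ G.d)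
    (h' : (z' ≫ pullback.snd F.f₀ G.d) ≫ G.c = a ≫ G.d)
    (hz : z ≫ fibreπ F = z' ≫ fibreπ F) :
    commaComp z a h ≫ fibreπ F = commaComp z' a h' ≫ fibreπ F := by
  obtain ⟨T', s, k, g, hk, hs, h₁, h₂⟩ := exists_arr_of_fibreπ_eq z z' hz
  have hg : g ≫ G.c = (s ≫ a) ≫ G.d := by
    rw [Category.assoc, ← h', ← Category.assoc, ← Category.assoc, h₂, pullback.lift_snd]
  rw [← cancel_epi s, ← Category.assoc, ← Category.assoc, precomp_commaComp, precomp_commaComp]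
  have hk' : (k ≫ F.f₁) ≫ G.c = G.comp g (s ≫ a) hg ≫ G.d := by rw [comp_d, hk]
  refine Eq.trans (congrArg (· ≫ fibreπ F) ?_)
    ((lift_comp_fibreπ k (G.comp g (s ≫ a) hg) hk').trans (congrArg (· ≫ fibreπ F) ?_))
  · apply pullback.hom_ext
    · simp [h₁]
    · refine (commaComp_snd _ _ _).trans (Eq.trans ?_ (pullback.lift_snd _ _ _).symm)
      exact (G.comp_congr ((h₁ =≫ _).trans (pullback.lift_snd _ _ _)) rfl _).trans
        (G.comp_assoc _ _ _ hk hg)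
  · apply pullback.hom_ext
    · simp [h₂]
    · refine (pullback.lift_snd _ _ _).trans (Eq.trans ?_ (commaComp_snd _ _ _).symm)
      exact (G.comp_congr ((h₂ =≫ _).trans (pullback.lift_snd _ _ _)) rfl _).symm

lemma fibreπ_condition {T : C} {p : fibreComponents F ⟶ G.obj}
    (hp : fibreπ F ≫ p = pullback.snd F.f₀ G.d ≫ G.c) {z : T ⟶ pullback F.f₀ G.d} {a : T ⟶ G.arr}
    (h : (z ≫ pullback.snd F.f₀ G.d) ≫ G.c = a ≫ G.d) :
    (z ≫ fibreπ F) ≫ p = a ≫ G.d := by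
  rw [Category.assoc, hp, ← h, Category.assoc]

/-- Postcomposition descends to the components of `F ↓ G`. -/
lemma exists_act (p : fibreComponents F ⟶ G.obj)
    (hp : fibreπ F ≫ p = pullback.snd F.f₀ G.d ≫ G.c) :
    ∃ act : pullback p G.d ⟶ fibreComponents F,
      ∀ {T : C} (z : T ⟶ pullback F.f₀ G.d) (a : T ⟶ G.arr)
        (h : (z ≫ pullback.snd F.f₀ G.d) ≫ G.c = a ≫ G.d),
        pullback.lift (z ≫ fibreπ F) a (fibreπ_condition hp h) ≫ act =
          commaComp z a h ≫ fibreπ F := by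
  -- The map `σ` covers the domain of the action by pairs of a representative `ζ` and an arrow `α`.
  -- Postcomposition is defined on representatives and descends along `σ`.
  let σ := pullback.snd (fibreπ F) (pullback.fst p G.d)
  let ζ := pullback.fst (fibreπ F) (pullback.fst p G.d)
  let α := σ ≫ pullback.snd p G.d
  have hσ : ζ ≫ fibreπ F = σ ≫ pullback.fst p G.d := pullback.condition
  have hζ : (ζ ≫ pullback.snd F.f₀ G.d) ≫ G.c = α ≫ G.d := by
    rw [Category.assoc, ← hp, reassoc_of% hσ, pullback.condition, Category.assoc]
  -- Two pairs identified by `σ` have the same arrow and representatives of the same component.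
  have hw : IsRegularEpi.left σ ≫ commaComp ζ α hζ ≫ fibreπ F =
      IsRegularEpi.right σ ≫ commaComp ζ α hζ ≫ fibreπ F := by
    have w := IsRegularEpi.w σ
    rw [← Category.assoc, ← Category.assoc, precomp_commaComp, precomp_commaComp,
      commaComp_congr rfl (show IsRegularEpi.left σ ≫ α = IsRegularEpi.right σ ≫ α by
        simp only [α, reassoc_of% w])]
    refine commaComp_fibreπ_congr _ _ _ _ _ ?_
    rw [Category.assoc, Category.assoc, hσ, reassoc_of% w]
  refine ⟨IsRegularEpi.desc σ _ hw, fun z a h => ?_⟩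
  let t := pullback.lift z (pullback.lift (z ≫ fibreπ F) a (fibreπ_condition hp h))
    (pullback.lift_fst _ _ _).symm
  have ht : t ≫ σ = pullback.lift (z ≫ fibreπ F) a (fibreπ_condition hp h) :=
    pullback.lift_snd _ _ _
  rw [← ht, Category.assoc, IsRegularEpi.fac, ← Category.assoc, precomp_commaComp]
  congr 1
  exact commaComp_congr (pullback.lift_fst _ _ _)
    (by simp only [α, reassoc_of% ht, pullback.lift_snd]) _

/-- The map underlying the action of `G` on the components of `F ↓ G`. -/
noncomputable def componentsAct (p : fibreComponents F ⟶ G.obj)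
    (hp : fibreπ F ≫ p = pullback.snd F.f₀ G.d ≫ G.c) : pullback p G.d ⟶ fibreComponents F :=
  (exists_act p hp).choose

/-- The component `x` is kept apart from its representative so that the formula applies when `x` is
a restriction `s ≫ y` to a cover, or is itself the result of an action. -/
lemma lift_componentsAct (p : fibreComponents F ⟶ G.obj)
    (hp : fibreπ F ≫ p = pullback.snd F.f₀ G.d ≫ G.c) {T : C} {x : T ⟶ fibreComponents F}
    (z : T ⟶ pullback F.f₀ G.d) (hz : x = z ≫ fibreπ F) (a : T ⟶ G.arr)
    (h : (z ≫ pullback.snd F.f₀ G.d) ≫ G.c = a ≫ G.d) :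
    pullback.lift x a (by rw [hz, fibreπ_condition hp h]) ≫ componentsAct p hp =
      commaComp z a h ≫ fibreπ F := by
  subst hz
  exact (exists_act p hp).choose_spec z a h

/-- Local representatives of generalized elements of the object of components. -/
lemma exists_fibreπ_cover {T : C} (x : T ⟶ fibreComponents F) :
    ∃ (T' : C) (s : T' ⟶ T) (z : T' ⟶ pullback F.f₀ G.d), IsRegularEpi s ∧
      s ≫ x = z ≫ fibreπ F :=
  ⟨_, pullback.snd (fibreπ F) x, pullback.fst _ _, inferInstance, pullback.condition.symm⟩

/-- The action of `G` on the components of `F ↓ G`. -/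
noncomputable def componentsAction (p : fibreComponents F ⟶ G.obj)
    (hp : fibreπ F ≫ p = pullback.snd F.f₀ G.d ≫ G.c) : RightAction G where
  P := fibreComponents F
  p := p
  act := componentsAct p hp
  act_p := by
    -- The action laws are checked on local representatives, where they are the laws of `commaComp`.
    obtain ⟨T', s, z, hs, hz⟩ := exists_fibreπ_cover (pullback.fst p G.d)
    have h : (z ≫ pullback.snd F.f₀ G.d) ≫ G.c = (s ≫ pullback.snd p G.d) ≫ G.d := by
      rw [Category.assoc, ← hp, ← Category.assoc, ← hz, Category.assoc, Category.assoc,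
        pullback.condition]
    have key := lift_componentsAct p hp z hz (s ≫ pullback.snd p G.d) h
    rw [← precomp_lift s _ _ pullback.condition, Category.assoc] at key
    have h' : pullback.lift (pullback.fst p G.d) (pullback.snd p G.d) pullback.condition = 𝟙 _ := by
      apply pullback.hom_ext <;> simp
    rw [h', Category.id_comp] at key
    rw [← cancel_epi s, ← Category.assoc, key, Category.assoc, hp, ← Category.assoc,
      commaComp_snd, comp_c, Category.assoc]
  act_e := by
    rw [← cancel_epi (fibreπ F), ← Category.assoc, precomp_lift]
    have h : (𝟙 _ ≫ pullback.snd F.f₀ G.d) ≫ G.c = ((fibreπ F ≫ p) ≫ G.e) ≫ G.d := by simp [hp]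
    -- Here `fibreπ F` is the cover, and the identity is the universal representative.
    have key := lift_componentsAct p hp (x := fibreπ F ≫ 𝟙 _) (𝟙 _) (by simp) _ h
    rw [commaComp_e _ _ (by simp [hp])] at key
    rw [lift_congr rfl (Category.assoc _ _ _).symm]
    exact key.trans ((Category.id_comp _).trans (Category.comp_id _).symm)
  act_act x a b h hab := by
    obtain ⟨T', s, z, hs, hz⟩ := exists_fibreπ_cover x
    have hza : (z ≫ pullback.snd F.f₀ G.d) ≫ G.c = (s ≫ a) ≫ G.d := by
      rw [Category.assoc, ← hp, ← Category.assoc, ← hz, Category.assoc, h, Category.assoc]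
    have hab' : (s ≫ a) ≫ G.c = (s ≫ b) ≫ G.d := by rw [Category.assoc, hab, Category.assoc]
    have h₁ := lift_componentsAct p hp z hz (s ≫ a) hza
    rw [← precomp_lift s x a h, Category.assoc] at h₁
    have h₂ := lift_componentsAct p hp (commaComp z (s ≫ a) hza) h₁ (s ≫ b) (by simp [hab])
    have h₃ := lift_componentsAct p hp z hz (s ≫ G.comp a b hab) (by simpa using hza)
    rw [commaComp_commaComp _ _ _ _ hab'] at h₂
    rw [commaComp_congr rfl (G.precomp s a b hab)] at h₃
    rw [← cancel_epi s]
    refine (Category.assoc _ _ _).symm.trans (Eq.trans ?_ (Category.assoc _ _ _))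
    rw [precomp_lift, precomp_lift]
    exact h₂.trans h₃.symm

lemma componentsAction_smul (p : fibreComponents F ⟶ G.obj)
    (hp : fibreπ F ≫ p = pullback.snd F.f₀ G.d ≫ G.c) {T : C} (z : T ⟶ pullback F.f₀ G.d)
    (a : T ⟶ G.arr) (h : (z ≫ pullback.snd F.f₀ G.d) ≫ G.c = a ≫ G.d) :
    (componentsAction p hp).smul (z ≫ fibreπ F) a (fibreπ_condition hp h) =
      commaComp z a h ≫ fibreπ F :=
  lift_componentsAct p hp z rfl a h

/-- The components of `F ↓ G` are the objects of `G` when `F` is final. -/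
lemma isIso_of_isFinal (hF : IsFinal F) (p : fibreComponents F ⟶ G.obj)
    (hp : fibreπ F ≫ p = pullback.snd F.f₀ G.d ≫ G.c) : IsIso p := by
  let A := componentsAction p hp
  -- The map `η` is `x ↦ (x, 1)` with `1` the identity of `F x`; `u₀` and `u₁` below are the
  -- components of the induced lift of `F`.
  let η : H.obj ⟶ pullback F.f₀ G.d := pullback.lift (𝟙 _) (F.f₀ ≫ G.e) (by simp)
  have hη : η ≫ pullback.snd F.f₀ G.d = F.f₀ ≫ G.e := pullback.lift_snd _ _ _
  let u₀ : H.obj ⟶ fibreComponents F := η ≫ fibreπ F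
  have hu₀ : u₀ ≫ p = F.f₀ := by
    rw [Category.assoc, hp, reassoc_of% hη, G.e_c, Category.comp_id]
  have hu₁ : (H.d ≫ u₀) ≫ p = F.f₁ ≫ G.d := by rw [Category.assoc, hu₀, Hom.d_f₀]
  let u₁ : H.arr ⟶ A.groupoid.arr := pullback.lift (H.d ≫ u₀) F.f₁ hu₁
  have hη' {T : C} (x : T ⟶ H.obj) (a : T ⟶ G.arr) (h : x ≫ F.f₀ = a ≫ G.d) :
      ((x ≫ η) ≫ pullback.snd F.f₀ G.d) ≫ G.c = a ≫ G.d := by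
    rw [Category.assoc x η, hη, ← h]; simp
  -- In symbols, `[x, 1] · a = [x, a]`.
  have key {T : C} (x : T ⟶ H.obj) (a : T ⟶ G.arr) (h : x ≫ F.f₀ = a ≫ G.d)
      (h' : (x ≫ u₀) ≫ p = a ≫ G.d) :
      A.smul (x ≫ u₀) a h' = pullback.lift x a h ≫ fibreπ F := by
    refine (A.smul_congr (Category.assoc _ _ _).symm rfl _).trans
      ((componentsAction_smul p hp (x ≫ η) a (hη' x a h)).trans (congrArg (· ≫ fibreπ F) ?_))
    apply pullback.hom_ext
    · simp [η]
    · refine (commaComp_snd _ _ _).trans (Eq.trans ?_ (pullback.lift_snd _ _ _).symm)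
      refine (G.comp_congr ?_ rfl _).trans (G.e_comp a (x ≫ F.f₀) h)
      rw [Category.assoc, hη, Category.assoc]
  have hc : H.c ≫ u₀ = u₁ ≫ A.groupoid.c := by
    -- For `k : x ⟶ x'`, the arrow `k` joins `(x, F k)` to `(x', 1)`, so `[x, 1] · F k = [x, F k] =
    -- [x', 1]`.
    have h := lift_comp_fibreπ (F := F) (𝟙 H.arr) (F.f₁ ≫ G.c ≫ G.e) (by simp)
    refine ((Category.assoc _ _ _).symm.trans (congrArg (· ≫ fibreπ F) ?_)).trans
      (h.symm.trans ((congrArg (· ≫ fibreπ F) ?_).trans (key H.d F.f₁ (Hom.d_f₀ F) hu₁).symm))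
    · apply pullback.hom_ext
      · simp [η]
      · simp [η, Hom.c_comm_assoc]
    · refine lift_congr (Category.id_comp _) ?_ _
      refine (G.comp_congr (Category.id_comp _) (Category.assoc _ _ _).symm _).trans ?_
      exact G.comp_e _ _ rfl
  let U : H ⟶ A.groupoid := A.isDiscreteFibration_proj.liftHom F u₀ u₁ hu₀
    (pullback.lift_snd _ _ _) (pullback.lift_fst _ _ _).symm hc
  have hU : U ≫ A.proj = F ≫ 𝟙 G :=
    (hom_ext hu₀ (pullback.lift_snd _ _ _)).trans (Category.comp_id F).symm
  -- Lifting against the identity of `G` yields a section of the action groupoid that extends `U`.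
  obtain ⟨L, ⟨hL, hL'⟩, -⟩ := hF A.proj A.isDiscreteFibration_proj U (𝟙 G) hU
  obtain ⟨l₀, l₁, hl₀, hl₁, hl₂, hl₃, hl₄⟩ :
      ∃ (l₀ : G.obj ⟶ fibreComponents F) (l₁ : G.arr ⟶ pullback p G.d), F.f₀ ≫ l₀ = u₀ ∧
        l₁ ≫ pullback.snd p G.d = 𝟙 G.arr ∧ l₁ ≫ pullback.fst p G.d = G.d ≫ l₀ ∧
        l₀ ≫ p = 𝟙 G.obj ∧ G.c ≫ l₀ = l₁ ≫ A.act :=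
    ⟨L.f₀, L.f₁, congrArg Hom.f₀ hL, congrArg Hom.f₁ hL', L.d_f₀.symm, congrArg Hom.f₀ hL', L.c_f₀⟩
  have hd : (G.d ≫ l₀) ≫ p = 𝟙 _ ≫ G.d := by
    rw [Category.assoc, hl₃, Category.comp_id, Category.id_comp]
  have hLc : G.c ≫ l₀ = A.smul (G.d ≫ l₀) (𝟙 _) hd :=
    hl₄.trans ((A.precomp_act l₁).trans (A.smul_congr hl₂ hl₁ _))
  have hdu : (pullback.fst F.f₀ G.d ≫ u₀) ≫ p = pullback.snd F.f₀ G.d ≫ G.d := by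
    rw [Category.assoc, hu₀, pullback.condition]
  -- For `g : F x ⟶ y`: `l₀ y = l₀ (F x) · g = [x, 1] · g = [x, g]`.
  have hq : pullback.snd F.f₀ G.d ≫ G.c ≫ l₀ = fibreπ F := by
    refine (congrArg _ hLc).trans ((A.precomp_smul _ _ _ _).trans
      ((A.smul_congr ?_ (Category.comp_id _) _).trans ((key _ _ pullback.condition hdu).trans ?_)))
    · exact (pullback.condition_assoc l₀).symm.trans (congrArg _ hl₀)
    · rw [show pullback.lift (pullback.fst F.f₀ G.d) (pullback.snd F.f₀ G.d)
        pullback.condition = 𝟙 _ by apply pullback.hom_ext <;> simp, Category.id_comp]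
  refine ⟨l₀, ?_, hl₃⟩
  rw [← cancel_epi (fibreπ F), ← Category.assoc, hp, Category.assoc, Category.comp_id]
  exact hq

end Fibres

end InternalGroupoid

theorem lemma4p1 {C : Type u} [Category.{v} C] [BarrExact C] {H G : InternalGroupoid C}
    (F : H ⟶ G) :
    InternalGroupoid.IsFinal F ↔
      IsIso ((InternalGroupoid.π₀ C).map (pullback.snd F G.decCounit)) := by
  obtain ⟨p, hp, h⟩ := InternalGroupoid.exists_fibreComponents_hom F
  rw [h]
  exact ⟨fun hF => InternalGroupoid.isIso_of_isFinal hF p hp,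
    fun _ => InternalGroupoid.isFinal_of_isIso p hp⟩
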